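/- Let $\alpha,\beta\in\mathbb{R}$ and let $k\ge 1$ be an integer such that $\alpha\notin\{-1,-2,\dots\}$ and $\alpha+\beta-k\notin\{-1,-2,\dots\}$. Put $\lambda_x^{\xi}=-x(x+\xi)$, write $(a)_n$ for the Pochhammer symbol, and for $n\ge 0$ let $$p_n^{\alpha,\beta}(t)=(-1)^n\frac{(\alpha+\beta+1)_n}{n!}\,\frac{(\beta+1)_n}{(\alpha+1)_n}\;{}_2F_1\!\left(-n,\,n+\alpha+\beta+1;\,\beta+1;\,t\right)$$ be the Jacobi polynomials, where $(\beta+1)_n/(\beta+1)_i$ is read as $(\beta+1+i)_{n-i}$, so that the formula is defined for every real $\beta$; set $p_n^{\alpha,\beta}=0$ for $n<0$. Let $$\mathcal{D}_1=(t-1)\partial_t,\qquad \mathcal{D}_2=(1-t)\partial_t^2-(\alpha+1)\partial_t,\qquad \mathcal{M}_1^{\alpha,\beta}=t(1-t)\partial_t^2+[(\beta+1)-(\alpha+\beta+2)t]\,\partial_t ,$$ and let $\mathfrak{D}_\alpha=\mathbb{R}\langle\mathcal{D}_1,\mathcal{D}_2\rangle$ be the associative algebra of differential operators generated by $\mathcal{D}_1$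 and $\mathcal{D}_2$. For functions of $n\in\mathbb{Z}$ let $\mathrm{Wr}_n(f^{(1)},\dots,f^{(m)})=\det\big(f^{(i)}_{n-j+1}\big)_{1\le i,j\le m}$. Let $\psi=(\psi^{(0)}_n,\dots,\psi^{(k-1)}_n)$ be functions in $(-1)^n\mathbb{R}[\lambda_n^{\alpha+\beta+1}]$ (each is $(-1)^n$ times a polynomial in $\lambda_n^{\alpha+\beta+1}$) such that $$\tau_n=\mathrm{Wr}_n\big((-1)^n\psi_n^{(0)},\dots,(-1)^n\psi_n^{(k-1)}\big)$$ is not identically zero, and put $q_n^{\alpha,\beta;\psi}(t)=\mathrm{Wr}_n\big(\psi_n^{(0)},\dots,\psi_n^{(k-1)},p_n^{\alpha,\beta}(t)\big)$. Let $\mathfrak{A}^{\alpha,\beta;\psi}$ be the set of all $f\in\mathbb{R}[t]$ such that $f\big(\lambda_{n-k/2}^{\alpha+\beta+1}\big)-f\big(\lambda_{n-k/2-1}^{\alpha+\beta+1}\big)$ is divisible by $\tau_{n-1}$ in $\mathbb{R}[n]$. Let $c_{n,k}^{\alpha+\beta}=(-1)^{nk}$ if $k\equiv 0,3\pmod 4$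 and $c_{n,k}^{\alpha+\beta}=(-1)^{nk}(2n+\alpha+\beta-k+1)$ if $k\equiv 1,2\pmod 4$. Then there is a unique operator $\hat{\mathcal{B}}_\psi\in\mathfrak{D}_\alpha$ with $$q_n^{\alpha,\beta;\psi}=c_{n,k}^{\alpha+\beta}\,\hat{\mathcal{B}}_\psi\big[p_n^{\alpha,\beta-k}\big]\quad\text{for all } n\ge 0,$$ for every $f\in\mathfrak{A}^{\alpha,\beta;\psi}$ there is a unique operator $\mathcal{B}_f\in\mathfrak{D}_\alpha$ with $$\mathcal{B}_f\big[q_n^{\alpha,\beta;\psi}\big]=f\big(\lambda_{n-k/2}^{\alpha+\beta+1}\big)\,q_n^{\alpha,\beta;\psi}\quad\text{for all } n\ge 0,$$ the operator $\hat{\mathcal{B}}_\psi$ is nonzero, and for every $f\in\mathfrak{A}^{\alpha,\beta;\psi}$ $$\mathcal{B}_f\,\hat{\mathcal{B}}_\psi=\hat{\mathcal{B}}_\psi\, f\big(\mathcal{M}_1^{\alpha,\beta-k}+\lambda_{k/2}^{-\alpha-\beta-1}\big).$$ Thus $\mathcal{B}_f$ is a Darboux transformation of a polynomial in the hypergeometric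 operator $\mathcal{M}_1^{\alpha,\beta-k}$, with intertwining operator $\hat{\mathcal{B}}_\psi\in\mathfrak{D}_\alpha$. -/

import Mathlib

open Polynomial

noncomputable section

namespace JacobiDarboux

/-- The Pochhammer symbol `(x)_n = x (x + 1) ⋯ (x + n - 1)`. -/
def poch (x : ℝ) (n : ℕ) : ℝ := (ascPochhammer ℝ n).eval x

/-- `λ_x^ξ = -x (x + ξ)`, for a real lower index `x`. -/
def lam (ξ x : ℝ) : ℝ := -x * (x + ξ)

/-- The Jacobi polynomial
`p_n^{α,β}(t) = (-1)^n (α+β+1)_n / n! * (β+1)_n / (α+1)_n * ₂F₁(-n, n+α+β+1; β+1; t)`, `n ≥ 0`.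
The quotient `(β+1)_n / (β+1)_i` that multiplies the `i`-th term of the (terminating) series is
written in lowest terms as `(β+1+i)_{n-i}`, so that the formula makes sense for every real `β`. -/
def jacobi (α β : ℝ) (n : ℕ) : ℝ[X] :=
  C ((-1) ^ n * poch (α + β + 1) n / ((n.factorial : ℝ) * poch (α + 1) n)) *
    ∑ i ∈ Finset.range (n + 1),
      C (poch (-(n : ℝ)) i * poch ((n : ℝ) + α + β + 1) i * poch (β + 1 + (i : ℝ)) (n - i) /
        (i.factorial : ℝ)) * X ^ i

/-- The Jacobi polynomials indexed by `ℤ`, with `p_n^{α,β} = 0` for `n < 0`. -/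
def jacobiZ (α β : ℝ) (n : ℤ) : ℝ[X] :=
  if n < 0 then 0 else jacobi α β n.toNat

/-- The discrete Wronskian `Wr_n (f^{(1)}, …, f^{(m)}) = det (f^{(i)}_{n-j+1})_{1 ≤ i,j ≤ m}`
(here the indices `i, j` start at `0`). -/
def discreteWronskian {R : Type*} [CommRing R] {m : ℕ} (f : Fin m → ℤ → R) (n : ℤ) : R :=
  Matrix.det (Matrix.of fun i j : Fin m => f i (n - ((j : ℕ) : ℤ)))

/-- The space `(-1)^n ℝ[λ_n^ξ]` of functions of the integer `n`. -/
def signedLamPolynomials (ξ : ℝ) : Set (ℤ → ℝ) :=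
  {φ | ∃ g : ℝ[X], ∀ n : ℤ, φ n = (-1 : ℝ) ^ n * g.eval (lam ξ (n : ℝ))}

/-- `q_n^{α,β;ψ}(t) = Wr_n (ψ^{(0)}, …, ψ^{(k-1)}, p^{α,β}(t))`. -/
def qPoly (α β : ℝ) {k : ℕ} (ψ : Fin k → ℤ → ℝ) (n : ℤ) : ℝ[X] :=
  discreteWronskian
    (Fin.snoc (α := fun _ : Fin (k + 1) => ℤ → ℝ[X])
      (fun j m => C (ψ j m)) (fun m => jacobiZ α β m)) n

/-- `τ_n = Wr_n ((-1)^n ψ^{(0)}, …, (-1)^n ψ^{(k-1)})`. -/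
def tau {k : ℕ} (ψ : Fin k → ℤ → ℝ) (n : ℤ) : ℝ :=
  discreteWronskian (fun j m => (-1 : ℝ) ^ m * ψ j m) n

/-- The set `𝔄^{α,β;ψ}` of the polynomials `f` for which
`f (λ_{n-k/2}^{α+β+1}) - f (λ_{n-k/2-1}^{α+β+1})` is divisible by `τ_{n-1}` in `ℝ[n]`.
(All terms are polynomials in `n`, and an identity of polynomials may be tested on `ℤ`.) -/
def krallAlgebra (α β : ℝ) {k : ℕ} (ψ : Fin k → ℤ → ℝ) : Set ℝ[X] :=
  {f | ∃ r : ℝ[X], ∀ n : ℤ,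
    f.eval (lam (α + β + 1) ((n : ℝ) - (k : ℝ) / 2)) -
      f.eval (lam (α + β + 1) ((n : ℝ) - (k : ℝ) / 2 - 1)) =
    r.eval (n : ℝ) * tau ψ (n - 1)}

/-! Differential operators with coefficients in `ℝ[t]` are represented by their (faithful) action
on `ℝ[t]`; the product in `Module.End ℝ ℝ[X]` is composition of operators. -/

/-- The operator of multiplication by the polynomial `a(t)`. -/
def mulOp (a : ℝ[X]) : Module.End ℝ ℝ[X] := LinearMap.mulLeft ℝ a

/-- The operator `∂_t`. -/
def dt : Module.End ℝ ℝ[X] := Polynomial.derivative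

/-- `𝒟₁ = (t - 1) ∂_t`. -/
def opD₁ : Module.End ℝ ℝ[X] := mulOp (X - 1) * dt

/-- `𝒟₂ = (1 - t) ∂_t² - (α + 1) ∂_t`. -/
def opD₂ (α : ℝ) : Module.End ℝ ℝ[X] := mulOp (1 - X) * dt ^ 2 - (α + 1) • dt

/-- `𝔇_α = ℝ⟨𝒟₁, 𝒟₂⟩`, the associative algebra generated by `𝒟₁` and `𝒟₂`. -/
def algD (α : ℝ) : Subalgebra ℝ (Module.End ℝ ℝ[X]) :=
  Algebra.adjoin ℝ {opD₁, opD₂ α}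

/-- The hypergeometric operator
`ℳ₁^{α,β} = t (1 - t) ∂_t² + [(β + 1) - (α + β + 2) t] ∂_t`. -/
def opM (α β : ℝ) : Module.End ℝ ℝ[X] :=
  mulOp (X * (1 - X)) * dt ^ 2 + mulOp (C (β + 1) - C (α + β + 2) * X) * dt

/-- The factor `c_{n,k}^{s}`, equal to `(-1)^{nk}` if `k ≡ 0, 3 (mod 4)` and to
`(-1)^{nk} (2n + s - k + 1)` if `k ≡ 1, 2 (mod 4)`. -/
def cFactor (s : ℝ) (n k : ℕ) : ℝ :=
  if k % 4 = 0 ∨ k % 4 = 3 then (-1) ^ (n * k)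
  else (-1) ^ (n * k) * (2 * (n : ℝ) + s - (k : ℝ) + 1)

/-- `B` is the operator `ℬ̂_ψ`: it lies in `𝔇_α`, and
`q_n^{α,β;ψ} = c_{n,k}^{α+β} B [p_n^{α,β-k}]` for all `n ≥ 0`. -/
def IsBHat (α β : ℝ) {k : ℕ} (ψ : Fin k → ℤ → ℝ) (B : Module.End ℝ ℝ[X]) : Prop :=
  B ∈ algD α ∧
    ∀ n : ℕ, qPoly α β ψ (n : ℤ) = cFactor (α + β) n k • B (jacobi α (β - (k : ℝ)) n)

/-- `B` is the operator `ℬ_f`: it lies in `𝔇_α`, and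
`B [q_n^{α,β;ψ}] = f (λ_{n-k/2}^{α+β+1}) q_n^{α,β;ψ}` for all `n ≥ 0`. -/
def IsBf (α β : ℝ) {k : ℕ} (ψ : Fin k → ℤ → ℝ) (f : ℝ[X]) (B : Module.End ℝ ℝ[X]) : Prop :=
  B ∈ algD α ∧
    ∀ n : ℕ, B (qPoly α β ψ (n : ℤ)) =
      f.eval (lam (α + β + 1) ((n : ℝ) - (k : ℝ) / 2)) • qPoly α β ψ (n : ℤ)

end JacobiDarboux

end

noncomputable section

namespace JacobiDarboux

/-! ### The sign of the order-reversing permutation -/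

/-! Everything is computed in the basis e_i = (1-t)^i / ((α+1)_i i!), where 𝒟₁ is diagonal with
eigenvalue i and 𝒟₂ lowers e_i to e_{i-1}. Put s = α+β+1. The coefficient of e_i in p_n is (-1)^i
(s)_{n+i} / (n-i)! (`jacobi_eq_sum`), so β enters only through s.

Intertwiner. Passing from p_n^{α,β-k} to p_{n-j}^{α,β} multiplies the coefficient of e_i by a
polynomial in i and n, up to a constant (`poch_mul_jacobiWeight`). Hence q_n arises from p_n^{α,β-k}
by multiplying coefficients by a determinant in x = i, y = n. The reflection of y that fixes the
eigenvalue reverses the columns, so the determinant is even or odd; it is therefore P(x, λ_y), times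
a linear factor in the odd case (`exists_symbol`). Replacing x by 𝒟₁ and λ_y by the hypergeometric
operator yields the intertwiner (`exists_isBHat`).

Bispectral operator. It suffices to find B in 𝔇_α with B p_{n-j} = f(λ_{n-k/2}) p_{n-j} + ∑_l
ψ^{(l)}_{n-j} G_l for 0 ≤ j ≤ k, where G_l does not depend on j: the determinant defining q_n
annihilates the correction. Since 𝒟₁ + s/2 sends p_n to a multiple of itself plus an alternating sum
of all lower p_u with weights 2u+s (`sum_jacobi_eq`), the operators P_l(ℳ₁)(𝒟₁+s/2)g_l(ℳ₁) realise
any lower coefficients that are odd under reflection in u (`bispectralOp_jacobi`). The right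
coefficients come from τ with one column replaced, weighted by the quotient r of the divisibility
condition; coinciding columns and a telescoping sum give the required form (`bispectralOp_jacobiZ`).

Uniqueness. The p_n^{α,β-k} form a basis, which settles the intertwiner and the operator identity
(`ext_of_triangular`). The q_n have degree n only for large n, so for B_f one also needs that a
nonzero element of 𝔇_α cannot have image in bounded degree (`eq_zero_of_mem_algD`). -/

theorem sign_revPerm (n : ℕ) :
    ((Equiv.Perm.sign (Fin.revPerm : Equiv.Perm (Fin n)) : ℤ)) = (-1) ^ (n * (n - 1) / 2) := by
  rw [Equiv.Perm.sign_eq_prod_prod_Ioi]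
  have h : ∀ i : Fin n, (∏ j ∈ Finset.Ioi i,
      (if (Fin.revPerm i : Fin n) < Fin.revPerm j then (1 : ℤˣ) else -1)) = (-1) ^ (n - 1 - (i : ℕ)) := by
    intro i
    rw [Finset.prod_congr rfl (g := fun _ => (-1 : ℤˣ)), Finset.prod_const, Fin.card_Ioi]
    intro j hj
    rw [Finset.mem_Ioi] at hj
    rw [if_neg]
    simpa using hj.le
  rw [Finset.prod_congr rfl (fun i _ => h i), Finset.prod_pow_eq_pow_sum,
    Fin.sum_univ_eq_sum_range (fun i => n - 1 - i) n, Finset.sum_range_reflect (fun i => i) n,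
    Finset.sum_range_id]
  simp

/-- The parity of k(k+1)/2 is the source of the case distinction in `cFactor`. -/
theorem sign_revPerm_succ (k : ℕ) :
    ((Equiv.Perm.sign (Fin.revPerm : Equiv.Perm (Fin (k + 1))) : ℤ) : ℝ) =
      if k % 4 = 0 ∨ k % 4 = 3 then 1 else -1 := by
  rw [sign_revPerm]
  obtain ⟨q, hq⟩ : ∃ q, k = 4 * q + k % 4 := ⟨k / 4, by omega⟩
  have hlt : k % 4 < 4 := Nat.mod_lt _ (by norm_num)
  have key : ∀ a b : ℕ, (k + 1) * k = 2 * (2 * a + b) →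
      (((-1 : ℤ) ^ ((k + 1) * (k + 1 - 1) / 2) : ℤ) : ℝ) = (-1) ^ b := by
    intro a b h
    have : (k + 1) * (k + 1 - 1) / 2 = 2 * a + b := by
      rw [Nat.add_sub_cancel, h]; omega
    rw [this]; push_cast; rw [pow_add, pow_mul]; simp
  generalize k % 4 = m at hq hlt ⊢
  interval_cases m
  · rw [key (4 * q ^ 2 + q) 0 (by rw [hq]; ring)]; simp
  · rw [key (4 * q ^ 2 + 3 * q) 1 (by rw [hq]; ring)]; simp
  · rw [key (4 * q ^ 2 + 5 * q + 1) 1 (by rw [hq]; ring)]; simp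
  · rw [key (4 * q ^ 2 + 7 * q + 3) 0 (by rw [hq]; ring)]; simp

/-! ### Bivariate polynomials that are symmetric in one variable -/

theorem bivariate_ext {h h' : ℝ[X][X]} (H : ∀ x y, h.evalEval x y = h'.evalEval x y) : h = h' := by
  rw [← sub_eq_zero]
  refine Polynomial.eq_zero_of_infinite_isRoot _ ((Set.infinite_range_of_injective
    (f := fun y : ℝ => (C y : ℝ[X])) C_injective).mono ?_)
  rintro _ ⟨y, rfl⟩
  refine Polynomial.funext fun x => ?_
  have := H x y
  simp only [evalEval] at this
  simp [this]

theorem coeff_comp_neg_X {A : Type*} [CommRing A] (h : A[X]) (n : ℕ) :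
    (h.comp (-X)).coeff n = (-1) ^ n * h.coeff n := by
  rw [show (-X : A[X]) = C (-1) * X by simp, comp_C_mul_X_coeff, mul_comm]

theorem exists_comp_sq_of_comp_neg {A : Type*} [CommRing A] [IsDomain A] [CharZero A] {h : A[X]}
    (H : h.comp (-X) = h) : ∃ P : A[X], h = P.comp (X ^ 2) := by
  refine ⟨contract 2 h, ?_⟩
  rw [← expand_eq_comp_X_pow]
  ext n
  rw [coeff_expand (by norm_num), coeff_contract (by norm_num)]
  split_ifs with hn
  · rw [Nat.div_mul_cancel hn]
  · have h1 : (h.comp (-X)).coeff n = -h.coeff n := by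
      rw [coeff_comp_neg_X, Odd.neg_one_pow (by rwa [← Nat.not_even_iff_odd, even_iff_two_dvd])]
      ring
    rw [H] at h1
    exact self_eq_neg.mp h1

theorem exists_X_mul_comp_sq_of_comp_neg {A : Type*} [CommRing A] [IsDomain A] [CharZero A]
    {h : A[X]} (H : h.comp (-X) = -h) : ∃ P : A[X], h = X * P.comp (X ^ 2) := by
  have h0 : h.coeff 0 = 0 := by
    have := congrArg (fun p => coeff p 0) H
    simp only [coeff_neg] at this
    rw [coeff_comp_neg_X] at this
    simpa [self_eq_neg] using this
  have hX : h = X * h.divX := by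
    conv_lhs => rw [← divX_mul_X_add h, h0]
    simp [mul_comm]
  have h1 : h.divX.comp (-X) = h.divX := by
    refine mul_left_cancel₀ (X_ne_zero (R := A)) ?_
    have := hX ▸ H
    rw [mul_comp, X_comp, neg_mul, neg_inj] at this
    rw [← hX] at this ⊢
    exact this
  obtain ⟨P, hP⟩ := exists_comp_sq_of_comp_neg h1
  exact ⟨P, by rw [← hP, ← hX]⟩

/-- With z = y + s/2 the symmetry is evenness in z, and `lam s y` equals s²/4 - z². -/
theorem exists_lam_of_symm (s : ℝ) (h : ℝ[X][X])
    (H : ∀ x y, h.evalEval x (-y - s) = h.evalEval x y) :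
    ∃ P : ℝ[X][X], ∀ x y, h.evalEval x y = P.evalEval x (lam s y) := by
  obtain ⟨P, hP⟩ := exists_comp_sq_of_comp_neg (h := h.comp (X - C (C (s / 2)))) (by
    refine bivariate_ext fun x y => ?_
    have := H x (y - s / 2)
    simp only [evalEval, eval_comp, eval_sub, eval_X, eval_C, eval_neg, ← C_sub, ← C_neg] at this ⊢
    rw [← this]
    congr 3
    ring)
  refine ⟨P.comp (C (C (s ^ 2 / 4)) - X), fun x y => ?_⟩
  have := congrArg (evalEval x (y + s / 2)) hP
  simp only [evalEval, eval_comp, eval_sub, eval_X, eval_C, eval_pow, ← C_sub, ← C_pow, lam,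
    add_sub_cancel_right] at this ⊢
  rw [this]
  congr 3
  ring

theorem exists_lam_of_antisymm (s : ℝ) (h : ℝ[X][X])
    (H : ∀ x y, h.evalEval x (-y - s) = -h.evalEval x y) :
    ∃ P : ℝ[X][X], ∀ x y, h.evalEval x y = (2 * y + s) * P.evalEval x (lam s y) := by
  obtain ⟨P, hP⟩ := exists_X_mul_comp_sq_of_comp_neg (h := h.comp (X - C (C (s / 2)))) (by
    refine bivariate_ext fun x y => ?_
    have := H x (y - s / 2)
    simp only [evalEval, eval_comp, eval_sub, eval_X, eval_C, eval_neg, ← C_sub, ← C_neg] at this ⊢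
    rw [← this]
    congr 3
    ring)
  refine ⟨C (C (1 / 2)) * P.comp (C (C (s ^ 2 / 4)) - X), fun x y => ?_⟩
  have := congrArg (evalEval x (y + s / 2)) hP
  simp only [evalEval, eval_comp, eval_sub, eval_X, eval_C, eval_pow, ← C_sub, ← C_pow, lam,
    add_sub_cancel_right, eval_mul] at this ⊢
  rw [this, show s ^ 2 / 4 - -y * (y + s) = (y + s / 2) ^ 2 by ring]
  ring

/-! ### Polynomial functions of two real variables -/

/-- The algebra of polynomial functions of two real variables. -/
def polyFun : Subalgebra ℝ (ℝ → ℝ → ℝ) where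
  carrier := {F | ∃ h : ℝ[X][X], ∀ x y, h.evalEval x y = F x y}
  mul_mem' := by
    rintro F G ⟨h, hh⟩ ⟨g, hg⟩
    exact ⟨h * g, fun x y => by simp [evalEval_mul, hh, hg]⟩
  add_mem' := by
    rintro F G ⟨h, hh⟩ ⟨g, hg⟩
    exact ⟨h + g, fun x y => by simp [evalEval_add, hh, hg]⟩
  algebraMap_mem' c := ⟨CC c, fun x y => by simp⟩

theorem const_mem_polyFun (c : ℝ) : (fun _ _ => c) ∈ polyFun := polyFun.algebraMap_mem c

theorem fst_mem_polyFun : (fun x _ => x) ∈ polyFun := ⟨C X, fun x y => by simp [evalEval_C]⟩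

theorem snd_mem_polyFun : (fun _ y => y) ∈ polyFun := ⟨X, fun x y => by simp⟩

theorem eval_mem_polyFun (p : ℝ[X]) {F : ℝ → ℝ → ℝ} (hF : F ∈ polyFun) :
    (fun x y => p.eval (F x y)) ∈ polyFun := by
  obtain ⟨h, hh⟩ := hF
  refine ⟨(p.map C).comp h, fun x y => ?_⟩
  change _ = p.eval (F x y)
  rw [← hh]
  simp only [evalEval, eval_comp]
  induction p using Polynomial.induction_on' with
  | add p q hp hq => simp [hp, hq]
  | monomial n a => simp

/-- By the Leibniz formula. Determinants can thus be manipulated pointwise over ℝ and turned into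
polynomials only at the end. -/
theorem det_mem_polyFun {n : ℕ} {A : Fin n → Fin n → ℝ → ℝ → ℝ} (hA : ∀ i j, A i j ∈ polyFun) :
    (fun x y => Matrix.det (Matrix.of fun i j => A i j x y)) ∈ polyFun := by
  have : (fun x y => Matrix.det (Matrix.of fun i j => A i j x y)) =
      ∑ σ : Equiv.Perm (Fin n), ((Equiv.Perm.sign σ : ℤ) : ℝ) • ∏ i, A (σ i) i := by
    ext x y
    simp [Matrix.det_apply', Finset.sum_apply, Finset.prod_apply]
  rw [this]
  exact sum_mem fun σ _ => Subalgebra.smul_mem _ (prod_mem fun i _ => hA _ _) _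

theorem exists_eval_of_mem_polyFun {F : ℝ → ℝ} (hF : (fun _ y => F y) ∈ polyFun) :
    ∃ p : ℝ[X], ∀ y, p.eval y = F y := by
  obtain ⟨h, hh⟩ := hF
  replace hh : ∀ x y, h.evalEval x y = F y := hh
  -- The first variable is a dummy and may be set to 0.
  refine ⟨h.map (evalRingHom 0), fun y => ?_⟩
  rw [← hh 0 y, map_evalRingHom_eval]

theorem exists_lam_of_mem_polyFun_of_symm {s : ℝ} {F : ℝ → ℝ} (hF : (fun _ y => F y) ∈ polyFun)
    (H : ∀ y, F (-y - s) = F y) : ∃ P : ℝ[X], ∀ y, F y = P.eval (lam s y) := by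
  obtain ⟨h, hh⟩ := hF
  replace hh : ∀ x y, h.evalEval x y = F y := hh
  obtain ⟨P, hP⟩ := exists_lam_of_symm s h (fun x y => by rw [hh, hh, H])
  refine ⟨P.map (evalRingHom 0), fun y => ?_⟩
  rw [← hh 0 y, hP, map_evalRingHom_eval]

theorem exists_lam_of_mem_polyFun_of_antisymm {s : ℝ} {F : ℝ → ℝ}
    (hF : (fun _ y => F y) ∈ polyFun) (H : ∀ y, F (-y - s) = -F y) :
    ∃ P : ℝ[X], ∀ y, F y = (2 * y + s) * P.eval (lam s y) := by
  obtain ⟨h, hh⟩ := hF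
  replace hh : ∀ x y, h.evalEval x y = F y := hh
  obtain ⟨P, hP⟩ := exists_lam_of_antisymm s h (fun x y => by rw [hh, hh, H])
  refine ⟨P.map (evalRingHom 0), fun y => ?_⟩
  rw [← hh 0 y, hP, map_evalRingHom_eval]

/-! ### Pochhammer symbols -/

theorem poch_zero (x : ℝ) : poch x 0 = 1 := by simp [poch]

theorem poch_succ (x : ℝ) (n : ℕ) : poch x (n + 1) = poch x n * (x + n) :=
  ascPochhammer_succ_eval n x

theorem poch_add (x : ℝ) (m n : ℕ) : poch x (m + n) = poch x m * poch (x + m) n := by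
  induction n with
  | zero => simp [poch_zero]
  | succ n ih => rw [← add_assoc, poch_succ, poch_succ, ih]; push_cast; ring

theorem poch_succ_left (x : ℝ) (n : ℕ) : poch x (n + 1) = x * poch (x + 1) n := by
  rw [add_comm, poch_add, poch_succ, poch_zero]; simp

theorem poch_ne_zero {x : ℝ} (hx : ∀ m : ℕ, x + m ≠ 0) (n : ℕ) : poch x n ≠ 0 := by
  induction n with
  | zero => simp [poch_zero]
  | succ n ih => rw [poch_succ]; exact mul_ne_zero ih (hx n)

theorem poch_neg_self (n : ℕ) : poch (-(n : ℝ)) n = (-1) ^ n * n.factorial := by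
  rw [poch, ascPochhammer_eval_neg_eq_descPochhammer, descPochhammer_eval_eq_descFactorial,
    Nat.descFactorial_self]

/-! ### The operators on the basis of powers of `1 - t` -/

/-- The polynomial `(1 - t)^i / ((α+1)_i i!)`. -/
def shiftBasis (α : ℝ) (i : ℕ) : ℝ[X] := C (1 / (poch (α + 1) i * i.factorial)) * (1 - X) ^ i

theorem opD₁_apply (p : ℝ[X]) : opD₁ p = (X - 1) * derivative p := rfl

theorem opD₂_apply (α : ℝ) (p : ℝ[X]) :
    opD₂ α p = (1 - X) * derivative (derivative p) - C (α + 1) * derivative p := by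
  simp [opD₂, mulOp, dt, pow_two, smul_eq_C_mul]

theorem opM_apply (α β : ℝ) (p : ℝ[X]) :
    opM α β p = X * (1 - X) * derivative (derivative p) +
      (C (β + 1) - C (α + β + 2) * X) * derivative p := by
  simp [opM, mulOp, dt, pow_two, mul_assoc]

theorem opM_eq (α β : ℝ) :
    opM α β = opD₂ α - opD₁ ^ 2 - (α + β + 1) • opD₁ := by
  refine LinearMap.ext fun p => ?_
  simp only [opM_apply, LinearMap.sub_apply, LinearMap.smul_apply, pow_two, Module.End.mul_apply,
    opD₂_apply, opD₁_apply, derivative_mul, derivative_sub, derivative_X, derivative_one,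
    smul_eq_C_mul, C_add, C_1]
  rw [show (C (2 : ℝ) : ℝ[X]) = 1 + 1 by rw [← C_1, ← C_add]; norm_num]
  ring

theorem opM_mem_algD (α β : ℝ) : opM α β ∈ algD α := by
  have h1 : opD₁ ∈ algD α := Algebra.subset_adjoin (by simp)
  have h2 : opD₂ α ∈ algD α := Algebra.subset_adjoin (by simp)
  rw [opM_eq]
  exact sub_mem (sub_mem h2 (pow_mem h1 2)) (Subalgebra.smul_mem _ h1 _)

theorem opD₁_mem_algD (α : ℝ) : opD₁ ∈ algD α := Algebra.subset_adjoin (by simp)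

theorem aeval_mem_algD {α : ℝ} {T : Module.End ℝ ℝ[X]} (hT : T ∈ algD α) (p : ℝ[X]) :
    aeval T p ∈ algD α :=
  Algebra.adjoin_le (S := algD α) (by simpa using hT) (aeval_mem_adjoin_singleton ℝ T)

theorem opD₁_shiftBasis (α : ℝ) (i : ℕ) : opD₁ (shiftBasis α i) = (i : ℝ) • shiftBasis α i := by
  rw [opD₁_apply, shiftBasis, smul_eq_C_mul]
  cases i with
  | zero => simp
  | succ i =>
    simp only [derivative_mul, derivative_C, derivative_pow, derivative_sub, derivative_one,
      derivative_X, Nat.add_sub_cancel, C_eq_natCast]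
    simp
    ring

theorem opD₂_shiftBasis_zero (α : ℝ) : opD₂ α (shiftBasis α 0) = 0 := by
  simp [opD₂_apply, shiftBasis]

theorem opD₂_shiftBasis_succ {α : ℝ} (hα : ∀ m : ℕ, α + 1 + (m : ℝ) ≠ 0) (i : ℕ) :
    opD₂ α (shiftBasis α (i + 1)) = shiftBasis α i := by
  have hc : C (1 / (poch (α + 1) i * i.factorial)) =
      C (1 / (poch (α + 1) (i + 1) * (i + 1).factorial)) * C ((α + 1 + i) * (i + 1)) := by
    rw [← C_mul, poch_succ, Nat.factorial_succ]
    congr 1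
    have := hα i
    have := poch_ne_zero hα i
    push_cast
    have : (i : ℝ) + 1 ≠ 0 := by positivity
    have : (i.factorial : ℝ) ≠ 0 := by positivity
    field_simp
  rw [opD₂_apply, shiftBasis, shiftBasis, hc]
  generalize 1 / (poch (α + 1) (i + 1) * ((i + 1).factorial : ℝ)) = c
  cases i with
  | zero => simp [derivative_mul]; ring
  | succ i =>
    simp [derivative_mul, derivative_pow]
    ring

theorem opM_shiftBasis_zero (α β : ℝ) : opM α β (shiftBasis α 0) = 0 := by
  simp [opM_apply, shiftBasis]

theorem opM_shiftBasis_succ {α : ℝ} (β : ℝ) (hα : ∀ m : ℕ, α + 1 + (m : ℝ) ≠ 0) (i : ℕ) :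
    opM α β (shiftBasis α (i + 1)) =
      shiftBasis α i + lam (α + β + 1) ((i + 1 : ℕ) : ℝ) • shiftBasis α (i + 1) := by
  rw [opM_eq]
  simp only [LinearMap.sub_apply, LinearMap.smul_apply, pow_two, Module.End.mul_apply,
    opD₂_shiftBasis_succ hα, opD₁_shiftBasis, map_smul, lam]
  module

theorem aeval_opD₁_shiftBasis (α : ℝ) (a : ℝ[X]) (i : ℕ) :
    aeval opD₁ a (shiftBasis α i) = a.eval (i : ℝ) • shiftBasis α i :=
  Module.End.aeval_apply_of_mem_apply_eq_smul (opD₁_shiftBasis α i)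

/-! ### The expansion of the Jacobi polynomials at `t = 1` -/

/-- The coefficient of `(1 - t)^i / ((α+1)_i i!)` in the `n`-th Jacobi polynomial, `s = α + β + 1`. -/
def jacobiWeight (s : ℝ) (n : ℤ) (i : ℕ) : ℝ :=
  if (i : ℤ) ≤ n then (-1) ^ i * poch s (n + i).toNat / ((n - i).toNat.factorial : ℝ) else 0

theorem jacobiWeight_of_lt (s : ℝ) {n : ℤ} {i : ℕ} (h : n < i) : jacobiWeight s n i = 0 :=
  if_neg (not_le.mpr h)

theorem jacobiWeight_add (s : ℝ) (i d : ℕ) :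
    jacobiWeight s ((i + d : ℕ) : ℤ) i = (-1) ^ i * poch s (i + d + i) / (d.factorial : ℝ) := by
  rw [jacobiWeight, if_pos (by push_cast; omega)]
  congr 3
  omega

/-- The factor is λ_n - λ_i, exactly what the eigenvector equation demands, as ℳ₁ e_{i+1} = e_i +
λ_{i+1} e_{i+1}. -/
theorem jacobiWeight_succ_right (s : ℝ) (n i : ℕ) :
    jacobiWeight s n (i + 1) = -(s + n + i) * (n - i) * jacobiWeight s n i := by
  rcases lt_trichotomy n i with h | rfl | h
  · rw [jacobiWeight_of_lt s (by push_cast; omega),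
      jacobiWeight_of_lt s (by exact_mod_cast h), mul_zero]
  · rw [jacobiWeight_of_lt s (by push_cast; omega)]
    simp
  · obtain ⟨d, rfl⟩ := Nat.exists_eq_add_of_lt h
    have h1 := jacobiWeight_add s (i + 1) d
    have h2 := jacobiWeight_add s i (d + 1)
    rw [show i + 1 + d = i + d + 1 by ring] at h1
    rw [show i + (d + 1) = i + d + 1 by ring] at h2
    rw [h1, h2, ← add_assoc, poch_succ, Nat.factorial_succ, pow_succ]
    push_cast
    have : (d.factorial : ℝ) ≠ 0 := by positivity
    have : (d : ℝ) + 1 ≠ 0 := by positivity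
    field_simp
    ring

/-- Coefficient form of (𝒟₁ - n - 1) p_{n+1} = -(𝒟₁ + n + s) p_n, the induction step of
`sum_jacobi_eq`. -/
theorem jacobiWeight_succ_left (s : ℝ) (n i : ℕ) :
    ((n : ℝ) + 1 - i) * jacobiWeight s ((n + 1 : ℕ) : ℤ) i =
      (s + n + i) * jacobiWeight s n i := by
  rcases lt_trichotomy (n + 1) i with h | rfl | h
  · rw [jacobiWeight_of_lt s (by exact_mod_cast h),
      jacobiWeight_of_lt s (by omega), mul_zero, mul_zero]
  · rw [jacobiWeight_of_lt s (n := (n : ℤ)) (by push_cast; omega)]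
    simp
  · obtain ⟨d, hd⟩ := Nat.exists_eq_add_of_le (Nat.lt_succ_iff.mp h)
    have h1 := jacobiWeight_add s i (d + 1)
    have h2 := jacobiWeight_add s i d
    rw [← add_assoc, ← hd] at h1
    rw [← hd] at h2
    rw [h1, h2, show n + 1 + i = n + i + 1 by ring, poch_succ, Nat.factorial_succ, hd]
    push_cast
    have : (d.factorial : ℝ) ≠ 0 := by positivity
    have : (d : ℝ) + 1 ≠ 0 := by positivity
    field_simp
    ring

theorem opM_sum_jacobiWeight {α : ℝ} (β : ℝ) (hα : ∀ m : ℕ, α + 1 + (m : ℝ) ≠ 0) (n : ℕ) :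
    opM α β (∑ i ∈ Finset.range (n + 1), jacobiWeight (α + β + 1) n i • shiftBasis α i) =
      lam (α + β + 1) n •
        ∑ i ∈ Finset.range (n + 1), jacobiWeight (α + β + 1) n i • shiftBasis α i := by
  set s := α + β + 1 with hs
  -- The truncation point N is freed from n for the induction; the top term receives no contribution
  -- from above.
  have h1 : ∀ N : ℕ, opM α β (∑ i ∈ Finset.range (N + 1), jacobiWeight s n i • shiftBasis α i) =
      ∑ i ∈ Finset.range N, (jacobiWeight s n (i + 1) + lam s i * jacobiWeight s n i) •
        shiftBasis α i + (lam s N * jacobiWeight s n N) • shiftBasis α N := by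
    intro N
    induction N with
    | zero => simp [opM_shiftBasis_zero, lam]
    | succ N ih =>
      rw [Finset.sum_range_succ, map_add, ih, Finset.sum_range_succ, map_smul,
        opM_shiftBasis_succ β hα, ← hs]
      module
  rw [h1, Finset.sum_range_succ, smul_add, Finset.smul_sum, smul_smul]
  congr 1
  refine Finset.sum_congr rfl fun i _ => ?_
  rw [smul_smul, jacobiWeight_succ_right]
  congr 1
  simp only [lam]
  ring

theorem coeff_opM (α β : ℝ) (p : ℝ[X]) (i : ℕ) :
    (opM α β p).coeff i =
      ((i : ℝ) + 1) * (i + β + 1) * p.coeff (i + 1) + lam (α + β + 1) i * p.coeff i := by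
  rw [opM_apply]
  rw [show X * (1 - X) * derivative (derivative p) + (C (β + 1) - C (α + β + 2) * X) * derivative p
    = X * derivative (derivative p) - X * (X * derivative (derivative p)) +
      (C (β + 1) * derivative p - C (α + β + 2) * (X * derivative p)) by ring]
  simp only [coeff_add, coeff_sub, coeff_C_mul, lam]
  rcases i with _ | _ | i
  · simp [coeff_derivative]
  · simp [coeff_derivative, coeff_X_mul]
    ring
  · simp [coeff_derivative, coeff_X_mul]
    ring

theorem lam_sub_lam (s x y : ℝ) : lam s x - lam s y = (y - x) * (x + y + s) := by
  simp only [lam]; ring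

/-- In powers of t the operator is triangular with diagonal entries λ_i, and λ_i ≠ λ_n for i < n
because s + n + i ≠ 0. Coefficients vanish by descent from the top. -/
theorem eq_zero_of_opM_eq {α β : ℝ} (hs : ∀ m : ℕ, α + β + 1 + (m : ℝ) ≠ 0) {n : ℕ} {y : ℝ[X]}
    (hy : ∀ i, n ≤ i → y.coeff i = 0) (hM : opM α β y = lam (α + β + 1) n • y) : y = 0 := by
  have key : ∀ d i, n ≤ i + d → y.coeff i = 0 := by
    intro d
    induction d with
    | zero => exact fun i hi => hy i hi
    | succ d ih =>
      intro i hi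
      by_cases hn : n ≤ i
      · exact hy i hn
      have h := congrArg (fun p => coeff p i) hM
      simp only [coeff_opM, coeff_smul, smul_eq_mul] at h
      rw [ih (i + 1) (by omega), mul_zero, zero_add, ← sub_eq_zero, ← sub_mul, lam_sub_lam,
        mul_eq_zero, mul_eq_zero] at h
      rcases h with (h | h) | h
      · have : (n : ℝ) = i := by linarith
        exact absurd (by exact_mod_cast this.le) hn
      · refine absurd ?_ (hs (i + n))
        push_cast
        linarith
      · exact h
  ext i
  exact key n i (by omega)

theorem coeff_jacobi (α β : ℝ) (n i : ℕ) :
    (jacobi α β n).coeff i = ((-1) ^ n * poch (α + β + 1) n / ((n.factorial : ℝ) * poch (α + 1) n)) *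
      if i ≤ n then poch (-(n : ℝ)) i * poch ((n : ℝ) + α + β + 1) i * poch (β + 1 + (i : ℝ)) (n - i) /
        (i.factorial : ℝ) else 0 := by
  rw [jacobi, coeff_C_mul, finsetSum_coeff]
  simp only [coeff_C_mul, coeff_X_pow, mul_ite, mul_one, mul_zero]
  rw [Finset.sum_ite_eq]
  simp

theorem opM_jacobi (α β : ℝ) (n : ℕ) :
    opM α β (jacobi α β n) = lam (α + β + 1) n • jacobi α β n := by
  ext i
  rw [coeff_opM, coeff_smul, smul_eq_mul, coeff_jacobi, coeff_jacobi]
  rcases lt_trichotomy n i with h | rfl | h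
  · rw [if_neg (by omega), if_neg (by omega)]; simp
  · rw [if_neg (by omega)]; simp
  · rw [if_pos (by omega), if_pos (by omega)]
    obtain ⟨d, rfl⟩ := Nat.exists_eq_add_of_lt h
    rw [show i + d + 1 - (i + 1) = d by omega, show i + d + 1 - i = d + 1 by omega,
      poch_succ_left (β + 1 + i), Nat.factorial_succ i, poch_succ _ i, poch_succ _ i]
    have : (i.factorial : ℝ) ≠ 0 := by positivity
    have : (i : ℝ) + 1 ≠ 0 := by positivity
    simp only [lam]
    push_cast
    rw [show β + 1 + (i : ℝ) + 1 = β + 1 + (i + 1) by ring]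
    field_simp
    ring

theorem coeff_shiftBasis_self (α : ℝ) (i : ℕ) :
    (shiftBasis α i).coeff i = (-1) ^ i / (poch (α + 1) i * i.factorial) := by
  rw [shiftBasis, coeff_C_mul, show (1 - X : ℝ[X]) ^ i = C ((-1) ^ i) * (X - C 1) ^ i by
    rw [C_pow, ← mul_pow]; simp, coeff_C_mul]
  have h := (monic_X_sub_C (1 : ℝ)).pow i
  have h2 : ((X - C (1 : ℝ)) ^ i).natDegree = i := by rw [natDegree_pow, natDegree_X_sub_C, mul_one]
  have : ((X - C (1 : ℝ)) ^ i).coeff i = 1 := by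
    conv_lhs => rw [← h2]
    rw [h2]
    rw [Monic, leadingCoeff, h2] at h
    exact h
  rw [this]
  ring

theorem coeff_shiftBasis_of_lt (α : ℝ) {i j : ℕ} (h : i < j) : (shiftBasis α i).coeff j = 0 := by
  rw [shiftBasis, coeff_C_mul, coeff_eq_zero_of_natDegree_lt, mul_zero]
  refine lt_of_le_of_lt (natDegree_pow_le_of_le i ((natDegree_sub_le _ _).trans (by simp) : _ ≤ 1)) ?_
  simpa using h

theorem coeff_sum_shiftBasis (α : ℝ) (c : ℕ → ℝ) (n : ℕ) :
    (∑ i ∈ Finset.range (n + 1), c i • shiftBasis α i).coeff n =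
      c n * ((-1) ^ n / (poch (α + 1) n * n.factorial)) := by
  rw [finsetSum_coeff, Finset.sum_range_succ, Finset.sum_eq_zero, zero_add, coeff_smul,
    coeff_shiftBasis_self, smul_eq_mul]
  intro i hi
  rw [coeff_smul, coeff_shiftBasis_of_lt α (Finset.mem_range.mp hi), smul_zero]

/-- Both sides solve the same eigenvalue equation and have the same coefficient of t^n, so their
difference falls under `eq_zero_of_opM_eq`. No summation formula at t = 1 is needed. -/
theorem jacobi_eq_sum {α β : ℝ} (hα : ∀ m : ℕ, α + 1 + (m : ℝ) ≠ 0)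
    (hs : ∀ m : ℕ, α + β + 1 + (m : ℝ) ≠ 0) (n : ℕ) :
    jacobi α β n =
      ∑ i ∈ Finset.range (n + 1), jacobiWeight (α + β + 1) n i • shiftBasis α i := by
  rw [← sub_eq_zero]
  refine eq_zero_of_opM_eq hs (n := n) (fun i hi => ?_) ?_
  · rcases hi.eq_or_lt with rfl | hi
    · rw [coeff_sub, coeff_sum_shiftBasis, coeff_jacobi, if_pos le_rfl, poch_neg_self,
        Nat.sub_self, poch_zero]
      have h := jacobiWeight_add (α + β + 1) n 0
      rw [add_zero, poch_add] at h
      rw [h, show (n : ℝ) + α + β + 1 = α + β + 1 + n by ring]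
      have := poch_ne_zero hα n
      have : (n.factorial : ℝ) ≠ 0 := by positivity
      simp only [Nat.factorial_zero, Nat.cast_one]
      field_simp
      ring
    · rw [coeff_sub, coeff_jacobi, if_neg (by omega), finsetSum_coeff, Finset.sum_eq_zero]
      · simp
      · intro j hj
        rw [coeff_smul, coeff_shiftBasis_of_lt α (by rw [Finset.mem_range] at hj; omega), smul_zero]
  · rw [map_sub, opM_jacobi, opM_sum_jacobiWeight β hα, smul_sub]

theorem jacobiZ_natCast (α β : ℝ) (n : ℕ) : jacobiZ α β n = jacobi α β n := by
  simp [jacobiZ]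

theorem jacobiZ_of_neg (α β : ℝ) {n : ℤ} (h : n < 0) : jacobiZ α β n = 0 := by
  simp [jacobiZ, h]

theorem jacobiZ_eq_sum {α β : ℝ} (hα : ∀ m : ℕ, α + 1 + (m : ℝ) ≠ 0)
    (hs : ∀ m : ℕ, α + β + 1 + (m : ℝ) ≠ 0) {n : ℤ} {N : ℕ} (hN : n < N) :
    jacobiZ α β n = ∑ i ∈ Finset.range N, jacobiWeight (α + β + 1) n i • shiftBasis α i := by
  rcases lt_or_ge n 0 with h | h
  · rw [jacobiZ_of_neg α β h, Finset.sum_eq_zero]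
    intro i _
    rw [jacobiWeight_of_lt _ (by omega), zero_smul]
  · obtain ⟨n, rfl⟩ := Int.eq_ofNat_of_zero_le h
    rw [jacobiZ_natCast, jacobi_eq_sum hα hs]
    refine Finset.sum_subset (fun i hi => ?_) fun i _ hi => ?_
    · rw [Finset.mem_range] at hi ⊢; omega
    · rw [Finset.mem_range] at hi
      rw [jacobiWeight_of_lt _ (by omega), zero_smul]

theorem aeval_opM_jacobi (α β : ℝ) (n : ℕ) (a : ℝ[X]) :
    aeval (opM α β) a (jacobi α β n) = a.eval (lam (α + β + 1) n) • jacobi α β n :=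
  Module.End.aeval_apply_of_mem_apply_eq_smul (opM_jacobi α β n)

theorem coeff_jacobi_self_ne_zero {α β : ℝ} (hα : ∀ m : ℕ, α + 1 + (m : ℝ) ≠ 0)
    (hs : ∀ m : ℕ, α + β + 1 + (m : ℝ) ≠ 0) (n : ℕ) : (jacobi α β n).coeff n ≠ 0 := by
  rw [jacobi_eq_sum hα hs, coeff_sum_shiftBasis]
  have h := jacobiWeight_add (α + β + 1) n 0
  rw [add_zero] at h
  rw [h]
  have := poch_ne_zero hα n
  have := poch_ne_zero hs (n + n)
  positivity

theorem coeff_jacobi_of_lt (α β : ℝ) {n i : ℕ} (h : n < i) : (jacobi α β n).coeff i = 0 := by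
  rw [coeff_jacobi, if_neg (by omega), mul_zero]

/-- The sum of all Jacobi polynomials of degree below `n`, weighted by `(-1)^u (2u + s)`, is
obtained from the `n`-th one by a first order operator. -/
theorem sum_jacobi_eq {α β : ℝ} (hα : ∀ m : ℕ, α + 1 + (m : ℝ) ≠ 0)
    (hs : ∀ m : ℕ, α + β + 1 + (m : ℝ) ≠ 0) (n : ℕ) :
    ∑ u ∈ Finset.range n, ((-1) ^ u * (2 * (u : ℝ) + (α + β + 1))) • jacobi α β u =
      ((-1 : ℝ) ^ n) • (opD₁ (jacobi α β n) - (n : ℝ) • jacobi α β n) := by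
  induction n with
  | zero =>
    rw [jacobi_eq_sum hα hs 0]
    simp [opD₁_shiftBasis]
  | succ n ih =>
    rw [Finset.sum_range_succ, ih]
    have h1 : opD₁ (jacobi α β (n + 1)) - ((n + 1 : ℕ) : ℝ) • jacobi α β (n + 1) =
        - (opD₁ (jacobi α β n) + (n + (α + β + 1) : ℝ) • jacobi α β n) := by
      rw [← jacobiZ_natCast, ← jacobiZ_natCast,
        jacobiZ_eq_sum hα hs (N := n + 2) (by push_cast; omega),
        jacobiZ_eq_sum hα hs (n := n) (N := n + 2) (by push_cast; omega), map_sum, map_sum,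
        Finset.smul_sum, Finset.smul_sum, ← Finset.sum_sub_distrib, ← Finset.sum_add_distrib,
        ← Finset.sum_neg_distrib]
      refine Finset.sum_congr rfl fun i _ => ?_
      rw [map_smul, map_smul, opD₁_shiftBasis, smul_smul, smul_smul, smul_smul, smul_smul,
        ← sub_smul, ← add_smul, ← neg_smul]
      congr 1
      have := jacobiWeight_succ_left (α + β + 1) n i
      push_cast at this ⊢
      linarith
    rw [h1, pow_succ]
    module

/-! ### The algebra `𝔇_α` -/

/-- The operator `∑_b a_b(𝒟₁) T^b` with symbol `∑_b a_b Y^b`. -/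
def symbolOp (T : Module.End ℝ ℝ[X]) (P : ℝ[X][X]) : Module.End ℝ ℝ[X] :=
  eval₂ (aeval opD₁ : ℝ[X] →ₐ[ℝ] Module.End ℝ ℝ[X]).toRingHom T P

theorem symbolOp_apply (T : Module.End ℝ ℝ[X]) (P : ℝ[X][X]) (p : ℝ[X]) :
    symbolOp T P p = ∑ b ∈ P.support, aeval opD₁ (P.coeff b) ((T ^ b) p) := by
  rw [symbolOp, eval₂_eq_sum, Polynomial.sum, LinearMap.sum_apply]
  rfl

theorem symbolOp_mem_algD {α : ℝ} {T : Module.End ℝ ℝ[X]} (hT : T ∈ algD α) (P : ℝ[X][X]) :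
    symbolOp T P ∈ algD α := by
  rw [symbolOp, eval₂_eq_sum, Polynomial.sum]
  exact sum_mem fun b _ => mul_mem (aeval_mem_algD (opD₁_mem_algD α) _) (pow_mem hT b)

theorem opD₂_mul_opD₁ (α : ℝ) : opD₂ α * opD₁ = (opD₁ + 1) * opD₂ α := by
  refine LinearMap.ext fun p => ?_
  simp only [Module.End.mul_apply, LinearMap.add_apply, Module.End.one_apply, opD₂_apply,
    opD₁_apply, derivative_mul, derivative_sub, derivative_add, derivative_X, derivative_one,
    derivative_C, derivative_zero]
  ring

theorem opD₂_mul_aeval (α : ℝ) (a : ℝ[X]) :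
    opD₂ α * aeval opD₁ a = aeval opD₁ (a.comp (X + 1)) * opD₂ α := by
  induction a using Polynomial.induction_on with
  | C a => simpa using (Algebra.commutes a (opD₂ α)).symm
  | add p q hp hq => simp only [map_add, add_comp, mul_add, add_mul, hp, hq]
  | monomial n a h =>
    rw [pow_succ, ← mul_assoc, map_mul, ← mul_assoc, h, mul_comp, map_mul, mul_assoc, mul_assoc,
      aeval_X, opD₂_mul_opD₁]
    simp [mul_assoc]

/-- Since 𝒟₂ a(𝒟₁) = a(𝒟₁+1) 𝒟₂, left multiplication by a generator preserves the normally ordered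
operators, with powers of 𝒟₂ on the right. Induction over the algebra shows this for every L, and L
is applied to the identity. -/
theorem exists_symbolOp_of_mem_algD {α : ℝ} {L : Module.End ℝ ℝ[X]} (hL : L ∈ algD α) :
    ∃ P, L = symbolOp (opD₂ α) P := by
  suffices h : ∀ P, ∃ P', L * symbolOp (opD₂ α) P = symbolOp (opD₂ α) P' by
    obtain ⟨P, hP⟩ := h 1
    exact ⟨P, by rw [← hP, symbolOp, eval₂_one, mul_one]⟩
  have of_monomial : ∀ x : Module.End ℝ ℝ[X],
      (∀ b a, ∃ P', x * symbolOp (opD₂ α) (monomial b a) = symbolOp (opD₂ α) P') →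
      ∀ P, ∃ P', x * symbolOp (opD₂ α) P = symbolOp (opD₂ α) P' := by
    intro x hx P
    induction P using Polynomial.induction_on' with
    | add p q hp hq =>
      obtain ⟨p', hp'⟩ := hp
      obtain ⟨q', hq'⟩ := hq
      refine ⟨p' + q', ?_⟩
      rw [symbolOp, symbolOp, eval₂_add, eval₂_add, mul_add]
      exact congrArg₂ (· + ·) hp' hq'
    | monomial b a => exact hx b a
  induction hL using Algebra.adjoin_induction with
  | mem x hx =>
    refine of_monomial x fun b a => ?_
    rcases hx with rfl | rfl
    · refine ⟨monomial b (X * a), ?_⟩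
      simp only [symbolOp, eval₂_monomial]
      simp [mul_assoc]
    · refine ⟨monomial (b + 1) (a.comp (X + 1)), ?_⟩
      simp only [symbolOp, eval₂_monomial]
      rw [← mul_assoc]
      change opD₂ α * aeval opD₁ a * _ = aeval opD₁ _ * _
      rw [opD₂_mul_aeval, mul_assoc, pow_succ']
  | algebraMap r =>
    refine of_monomial _ fun b a => ⟨monomial b (C r * a), ?_⟩
    simp only [symbolOp, eval₂_monomial]
    simp [mul_assoc]
  | add x y _ _ hx hy =>
    intro P
    obtain ⟨p', hp'⟩ := hx P
    obtain ⟨q', hq'⟩ := hy P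
    refine ⟨p' + q', ?_⟩
    rw [add_mul, hp', hq', symbolOp, symbolOp, symbolOp, eval₂_add]
  | mul x y _ _ hx hy =>
    intro P
    obtain ⟨q', hq'⟩ := hy P
    obtain ⟨p', hp'⟩ := hx q'
    exact ⟨p', by rw [mul_assoc, hq', hp']⟩

/-! ### Operators determined by their values on triangular families. -/

theorem opD₂_pow_shiftBasis {α : ℝ} (hα : ∀ m : ℕ, α + 1 + (m : ℝ) ≠ 0) (b i : ℕ) :
    (opD₂ α ^ b) (shiftBasis α i) = if b ≤ i then shiftBasis α (i - b) else 0 := by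
  induction b with
  | zero => simp
  | succ b ih =>
    rw [pow_succ', Module.End.mul_apply, ih]
    split_ifs with h h' h'
    · obtain ⟨d, rfl⟩ := Nat.exists_eq_add_of_le h'
      rw [show b + 1 + d - b = d + 1 by omega, opD₂_shiftBasis_succ hα]
      congr 1; omega
    · rw [show i - b = 0 by omega, opD₂_shiftBasis_zero]
    · omega
    · simp

/-- Neither generator raises the degree. -/
theorem coeff_of_mem_algD {α : ℝ} {L : Module.End ℝ ℝ[X]} (hL : L ∈ algD α) {N : ℕ} {p : ℝ[X]}
    (hp : ∀ i, N ≤ i → p.coeff i = 0) : ∀ i, N ≤ i → (L p).coeff i = 0 := by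
  induction hL using Algebra.adjoin_induction generalizing p with
  | mem x hx =>
    intro i hi
    rcases hx with rfl | rfl
    · rw [opD₁_apply, sub_mul, one_mul]
      rcases i with _ | i <;> simp [coeff_derivative, coeff_X_mul, hp _ hi, hp _ (hi.trans (Nat.le_succ _))]
    · rw [opD₂_apply, sub_mul, one_mul, coeff_sub, coeff_C_mul]
      rcases i with _ | i <;> simp [coeff_derivative, coeff_X_mul,
        hp _ (hi.trans (Nat.le_succ _)), hp _ ((hi.trans (Nat.le_succ _)).trans (Nat.le_succ _))]
  | algebraMap r =>
    intro i hi
    simp [Module.algebraMap_end_apply, hp i hi]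
  | add x y _ _ hx hy =>
    intro i hi
    simp [hx hp i hi, hy hp i hi]
  | mul x y _ _ hx hy => exact hx (hy hp)

theorem mem_of_triangular (W : Submodule ℝ ℝ[X]) (n₀ : ℕ) (q : ℕ → ℝ[X])
    (hW : ∀ p : ℝ[X], (∀ i, n₀ ≤ i → p.coeff i = 0) → p ∈ W)
    (hq : ∀ n, n₀ ≤ n → (q n).coeff n ≠ 0 ∧ (∀ i, n < i → (q n).coeff i = 0) ∧ q n ∈ W)
    (p : ℝ[X]) : p ∈ W := by
  have key : ∀ N : ℕ, ∀ p : ℝ[X], (∀ i, N ≤ i → p.coeff i = 0) → p ∈ W := by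
    intro N
    induction N with
    | zero => exact fun p hp => hW p fun i _ => hp i (Nat.zero_le i)
    | succ N ih =>
      intro p hp
      rcases lt_or_ge N n₀ with h | h
      · exact hW p fun i hi => hp i (by omega)
      · obtain ⟨h1, h2, h3⟩ := hq N h
        have := ih (p - (p.coeff N / (q N).coeff N) • q N) (fun i hi => by
          rw [coeff_sub, coeff_smul, smul_eq_mul]
          rcases hi.eq_or_lt with rfl | hi
          · field_simp
            ring
          · rw [hp i hi, h2 i hi]; simp)
        simpa using add_mem this (W.smul_mem (p.coeff N / (q N).coeff N) h3)
  exact key (p.natDegree + 1) p fun i hi => coeff_eq_zero_of_natDegree_lt (by omega)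

/-- The lowest power d of 𝒟₂ lowers the index least: among the images of e_{m+d} only its term
reaches degree m. -/
theorem coeff_symbolOp_shiftBasis {α : ℝ} (hα : ∀ m : ℕ, α + 1 + (m : ℝ) ≠ 0) (P : ℝ[X][X])
    (m : ℕ) : (symbolOp (opD₂ α) P (shiftBasis α (m + P.natTrailingDegree))).coeff m =
      P.trailingCoeff.eval (m : ℝ) * ((-1) ^ m / (poch (α + 1) m * m.factorial)) := by
  rw [symbolOp_apply, finsetSum_coeff, Finset.sum_eq_single P.natTrailingDegree]
  · rw [opD₂_pow_shiftBasis hα, if_pos (by omega), Nat.add_sub_cancel, aeval_opD₁_shiftBasis,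
      coeff_smul, coeff_shiftBasis_self, smul_eq_mul, trailingCoeff]
  · intro b hb hne
    have hlt : P.natTrailingDegree < b :=
      lt_of_le_of_ne (natTrailingDegree_le_of_mem_supp b hb) hne.symm
    rw [opD₂_pow_shiftBasis hα]
    split_ifs with h
    · rw [aeval_opD₁_shiftBasis, coeff_smul, coeff_shiftBasis_of_lt α (by omega), smul_zero]
    · simp
  · intro h
    have : P = 0 := by
      by_contra hP
      exact h (natTrailingDegree_mem_support_of_nonzero hP)
    simp [this]

/-- Modulo polynomials of degree below n₀, which L maps to such polynomials, everything is a
combination of the q_n; so L has image in degree below n₀. The trailing coefficient of its symbol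
then vanishes at every integer m ≥ n₀, hence identically. -/
theorem eq_zero_of_mem_algD {α : ℝ} (hα : ∀ m : ℕ, α + 1 + (m : ℝ) ≠ 0)
    {L : Module.End ℝ ℝ[X]} (hL : L ∈ algD α) (n₀ : ℕ) (q : ℕ → ℝ[X])
    (hq : ∀ n, n₀ ≤ n → (q n).coeff n ≠ 0 ∧ ∀ i, n < i → (q n).coeff i = 0)
    (hLq : ∀ n, L (q n) = 0) : L = 0 := by
  let W : Submodule ℝ ℝ[X] :=
    { carrier := {p | ∀ i, n₀ ≤ i → (L p).coeff i = 0}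
      zero_mem' := fun i _ => by simp
      add_mem' := fun hp hq i hi => by simp [hp i hi, hq i hi]
      smul_mem' := fun c p hp i hi => by simp [hp i hi] }
  have hW : ∀ p, p ∈ W := mem_of_triangular W n₀ q (fun p hp => coeff_of_mem_algD hL hp)
    fun n hn => ⟨(hq n hn).1, (hq n hn).2, fun i _ => by simp [hLq n]⟩
  obtain ⟨P, rfl⟩ := exists_symbolOp_of_mem_algD hL
  suffices P = 0 by rw [this, symbolOp, eval₂_zero]
  rw [← trailingCoeff_eq_zero]
  refine Polynomial.eq_zero_of_infinite_isRoot _ ((Set.infinite_range_of_injective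
    (f := fun m : ℕ => ((m + n₀ : ℕ) : ℝ)) ?_).mono ?_)
  · intro a b h
    simpa using h
  · rintro _ ⟨m, rfl⟩
    have h := hW (shiftBasis α (m + n₀ + P.natTrailingDegree)) (m + n₀) (by omega)
    rw [coeff_symbolOp_shiftBasis hα] at h
    have := poch_ne_zero hα (m + n₀)
    rw [mul_eq_zero] at h
    refine h.resolve_right ?_
    positivity

theorem ext_of_triangular {A B : Module.End ℝ ℝ[X]} (q : ℕ → ℝ[X])
    (hq : ∀ n, (q n).coeff n ≠ 0 ∧ ∀ i, n < i → (q n).coeff i = 0)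
    (h : ∀ n, A (q n) = B (q n)) : A = B := by
  refine LinearMap.ext fun p => ?_
  have := mem_of_triangular (LinearMap.eqLocus A B) 0 q
    (fun p hp => by
      have : p = 0 := by ext i; simpa using hp i (Nat.zero_le i)
      rw [this]; exact zero_mem _)
    (fun n _ => ⟨(hq n).1, (hq n).2, h n⟩) p
  exact this

/-! ### Expansion of a determinant along its last row -/

/-- The cofactors of the last row of a square matrix whose other rows are `A`. -/
def lastCofactor {R : Type*} [CommRing R] {k : ℕ} (A : Fin k → Fin (k + 1) → R) (j : Fin (k + 1)) :
    R :=
  (-1) ^ (k + (j : ℕ)) * Matrix.det (Matrix.of fun l j' : Fin k => A l (j.succAbove j'))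

/-- The square matrix with the rows `A` and the last row `v`. -/
def appendRow {R : Type*} {k : ℕ} (A : Fin k → Fin (k + 1) → R) (v : Fin (k + 1) → R) :
    Matrix (Fin (k + 1)) (Fin (k + 1)) R :=
  Matrix.of (Fin.snoc (α := fun _ => Fin (k + 1) → R) A v)

theorem appendRow_castSucc {R : Type*} {k : ℕ} (A : Fin k → Fin (k + 1) → R) (v : Fin (k + 1) → R)
    (l : Fin k) (j : Fin (k + 1)) : appendRow A v l.castSucc j = A l j := by
  simp [appendRow]

theorem appendRow_last {R : Type*} {k : ℕ} (A : Fin k → Fin (k + 1) → R) (v : Fin (k + 1) → R)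
    (j : Fin (k + 1)) : appendRow A v (Fin.last k) j = v j := by
  simp [appendRow]

theorem det_appendRow {R : Type*} [CommRing R] {k : ℕ} (A : Fin k → Fin (k + 1) → R)
    (v : Fin (k + 1) → R) : (appendRow A v).det = ∑ j, lastCofactor A j * v j := by
  rw [Matrix.det_succ_row _ (Fin.last k)]
  refine Finset.sum_congr rfl fun j _ => ?_
  rw [appendRow_last, lastCofactor, Fin.val_last, mul_right_comm]
  congr 3
  ext l j'
  simp [appendRow_castSucc]

/-- A repeated row. This removes the correction terms ψ^{(l)}_{n-j} G_l from the action on q_n. -/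
theorem sum_lastCofactor_mul_row {R : Type*} [CommRing R] {k : ℕ} (A : Fin k → Fin (k + 1) → R)
    (l : Fin k) : ∑ j, lastCofactor A j * A l j = 0 := by
  rw [← det_appendRow]
  refine Matrix.det_zero_of_row_eq (Fin.castSucc_lt_last l).ne ?_
  ext j
  rw [appendRow_castSucc, appendRow_last]

theorem lastCofactor_map {R S : Type*} [CommRing R] [CommRing S] (φ : R →+* S) {k : ℕ}
    (A : Fin k → Fin (k + 1) → R) (j : Fin (k + 1)) :
    lastCofactor (fun l j' => φ (A l j')) j = φ (lastCofactor A j) := by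
  rw [lastCofactor, lastCofactor, map_mul, RingHom.map_det]
  simp
  rfl

theorem qPoly_eq_sum (α β : ℝ) {k : ℕ} (ψ : Fin k → ℤ → ℝ) (n : ℤ) :
    qPoly α β ψ n = ∑ j : Fin (k + 1),
      lastCofactor (fun l (j : Fin (k + 1)) => ψ l (n - ((j : ℕ) : ℤ))) j •
        jacobiZ α β (n - ((j : ℕ) : ℤ)) := by
  have : qPoly α β ψ n = (appendRow (fun l (j : Fin (k + 1)) => C (ψ l (n - ((j : ℕ) : ℤ))))
      (fun j => jacobiZ α β (n - ((j : ℕ) : ℤ)))).det := by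
    rw [qPoly, discreteWronskian]
    congr 1
    ext1 i j
    refine Fin.lastCases ?_ (fun l => ?_) i
    · simp [appendRow_last]
    · simp [appendRow_castSucc]
  rw [this, det_appendRow]
  refine Finset.sum_congr rfl fun j _ => ?_
  rw [smul_eq_C_mul, ← lastCofactor_map]

/-! ### The intertwining operator -/

/-- The factor `(s+y+x)_{k-j} (y-x)(y-x-1)⋯(y-x-j+1)` by which the coefficients of
`p_{n-j}^{α,β}` and `p_n^{α,β-k}` differ. -/
def stepFactor (s : ℝ) (k : ℕ) (y x : ℝ) (j : Fin (k + 1)) : ℝ :=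
  poch (s + y + x) (k - j) * (descPochhammer ℝ j).eval (y - x)

/-- Two splittings of (s)_{n+i+k-j}, at k and at n+i, together with the falling factorial
(n-i)!/(n-i-j)!. When j > n-i, both the weight and the falling factorial are zero. -/
theorem poch_mul_jacobiWeight (s : ℝ) (k n i : ℕ) (j : Fin (k + 1)) (hi : i ≤ n) :
    poch s k * jacobiWeight (s + k) (n - ((j : ℕ) : ℤ)) i =
      stepFactor s k n i j * jacobiWeight s n i := by
  obtain ⟨j, hj⟩ := j
  obtain ⟨e, rfl⟩ := Nat.exists_eq_add_of_le hi
  have hdesc : (descPochhammer ℝ j).eval (((i + e : ℕ) : ℝ) - i) = e.descFactorial j := by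
    rw [← descPochhammer_eval_eq_descFactorial]
    push_cast
    ring_nf
  simp only [stepFactor]
  rw [hdesc]
  rcases lt_or_ge e j with h | h
  · rw [jacobiWeight_of_lt _ (by push_cast; omega), Nat.descFactorial_eq_zero_iff_lt.mpr h]
    simp
  · obtain ⟨d, rfl⟩ := Nat.exists_eq_add_of_le' h
    obtain ⟨c, hc⟩ := Nat.exists_eq_add_of_le (Nat.lt_succ_iff.mp hj)
    rw [show (((i + (d + j) : ℕ) : ℤ) - (j : ℤ)) = ((i + d : ℕ) : ℤ) by push_cast; ring,
      jacobiWeight_add, jacobiWeight_add]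
    have h1 := poch_add s k (i + d + i)
    have h2 := poch_add s (i + (d + j) + i) c
    rw [show k + (i + d + i) = i + (d + j) + i + c by omega, h2] at h1
    have h3 : (d.factorial : ℝ) * (d + j).descFactorial j = (d + j).factorial := by
      have := Nat.factorial_mul_descFactorial (n := d + j) (k := j) (by omega)
      rw [Nat.add_sub_cancel] at this
      exact_mod_cast this
    have h4 : ((d + j).factorial : ℝ) ≠ 0 := by positivity
    have h5 : (d.factorial : ℝ) ≠ 0 := by positivity
    rw [show k - j = c by omega]
    push_cast at h1 ⊢
    rw [show s + ((i : ℝ) + (d + j)) + i = s + (i + (d + j) + i) by ring]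
    rw [mul_div_assoc', mul_div_assoc', div_eq_div_iff h5 h4, ← h3]
    linear_combination (-(-1) ^ i * (d.factorial : ℝ) * (d + j).descFactorial j) * h1

/-! ### The symbol determinant and its reflection symmetry. -/

/-- The matrix whose determinant is the symbol of the intertwining operator, up to a factor. -/
def symbolMatrix (s : ℝ) {k : ℕ} (g : Fin k → ℝ[X]) (x y : ℝ) :
    Matrix (Fin (k + 1)) (Fin (k + 1)) ℝ :=
  appendRow (fun l j => (-1) ^ (j : ℕ) * (g l).eval (lam (s + k) (y - (j : ℕ))))
    (stepFactor s k y x)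

theorem poch_neg (z : ℝ) (m : ℕ) : poch (-z) m = (-1) ^ m * (descPochhammer ℝ m).eval z :=
  ascPochhammer_eval_neg_eq_descPochhammer ℝ z m

theorem descPochhammer_eval_neg (z : ℝ) (m : ℕ) :
    (descPochhammer ℝ m).eval (-z) = (-1) ^ m * poch z m := by
  have := poch_neg (-z) m
  rw [neg_neg] at this
  rw [this, ← mul_assoc, ← mul_pow]
  simp

/-- The reflection exchanges λ_{y-j} with λ_{y-(k-j)}, and rising with falling factorials in the
last row. -/
theorem symbolMatrix_reflect (s : ℝ) {k : ℕ} (g : Fin k → ℝ[X]) (x y : ℝ) :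
    symbolMatrix s g x (-y - s) =
      (-1 : ℝ) ^ k • (symbolMatrix s g x y).submatrix id Fin.revPerm := by
  ext i j
  have hj : ((Fin.rev j : Fin (k + 1)) : ℕ) = k - j := by rw [Fin.val_rev]; omega
  have hjk : (j : ℕ) ≤ k := Nat.lt_succ_iff.mp j.2
  have hsign : ((-1 : ℝ)) ^ k = (-1) ^ (k - (j : ℕ)) * (-1) ^ (j : ℕ) := by
    rw [← pow_add, Nat.sub_add_cancel hjk]
  have hsq : ((-1 : ℝ)) ^ (k - (j : ℕ)) * (-1) ^ (k - (j : ℕ)) = 1 := by rw [← mul_pow]; simp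
  simp only [Matrix.smul_apply, Matrix.submatrix_apply, id, Fin.revPerm_apply, smul_eq_mul,
    symbolMatrix]
  refine Fin.lastCases ?_ (fun l => ?_) i
  · rw [appendRow_last, appendRow_last, stepFactor, stepFactor, hj, Nat.sub_sub_self hjk,
      show s + (-y - s) + x = -(y - x) by ring, show -y - s - x = -(s + y + x) by ring,
      poch_neg, descPochhammer_eval_neg, hsign]
    ring
  · rw [appendRow_castSucc, appendRow_castSucc, hj, hsign, Nat.cast_sub hjk,
      show lam (s + k) (-y - s - (j : ℕ)) = lam (s + k) (y - ((k : ℝ) - (j : ℕ))) by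
        simp only [lam]; ring]
    linear_combination (-(-1) ^ (j : ℕ) * (g l).eval (lam (s + k) (y - ((k : ℝ) - (j : ℕ))))) * hsq

theorem det_symbolMatrix_reflect (s : ℝ) {k : ℕ} (g : Fin k → ℝ[X]) (x y : ℝ) :
    (symbolMatrix s g x (-y - s)).det =
      (if k % 4 = 0 ∨ k % 4 = 3 then 1 else -1) * (symbolMatrix s g x y).det := by
  rw [symbolMatrix_reflect, Matrix.det_smul, Matrix.det_permute', sign_revPerm_succ,
    Fintype.card_fin, ← pow_mul, Even.neg_one_pow (Nat.even_mul_succ_self k), one_mul]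

theorem lam_mem_polyFun (s : ℝ) {F : ℝ → ℝ → ℝ} (hF : F ∈ polyFun) :
    (fun x y => lam s (F x y)) ∈ polyFun := by
  have := eval_mem_polyFun (-X * (X + C s)) hF
  simpa [lam] using this

theorem det_symbolMatrix_mem_polyFun (s : ℝ) {k : ℕ} (g : Fin k → ℝ[X]) :
    (fun x y => (symbolMatrix s g x y).det) ∈ polyFun := by
  refine det_mem_polyFun (A := fun i j x y => symbolMatrix s g x y i j) fun i j => ?_
  refine Fin.lastCases ?_ (fun l => ?_) i
  · simp only [symbolMatrix, appendRow_last, stepFactor, poch]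
    exact mul_mem (eval_mem_polyFun _ (add_mem (add_mem (const_mem_polyFun s) snd_mem_polyFun)
      fst_mem_polyFun)) (eval_mem_polyFun _ (sub_mem snd_mem_polyFun fst_mem_polyFun))
  · simp only [symbolMatrix, appendRow_castSucc]
    exact mul_mem (const_mem_polyFun _) (eval_mem_polyFun _ (lam_mem_polyFun _
      (sub_mem snd_mem_polyFun (const_mem_polyFun _))))

theorem exists_symbol (s : ℝ) {k : ℕ} (g : Fin k → ℝ[X]) :
    ∃ P : ℝ[X][X], ∀ x y, (symbolMatrix s g x y).det =
      (if k % 4 = 0 ∨ k % 4 = 3 then 1 else 2 * y + s) * P.evalEval x (lam s y) := by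
  obtain ⟨h, hh⟩ := det_symbolMatrix_mem_polyFun s g
  replace hh : ∀ x y, h.evalEval x y = (symbolMatrix s g x y).det := hh
  split_ifs with hk
  · obtain ⟨P, hP⟩ := exists_lam_of_symm s h fun x y => by
      rw [hh, hh, det_symbolMatrix_reflect, if_pos hk, one_mul]
    exact ⟨P, fun x y => by rw [← hh, hP, one_mul]⟩
  · obtain ⟨P, hP⟩ := exists_lam_of_antisymm s h fun x y => by
      rw [hh, hh, det_symbolMatrix_reflect, if_neg hk, neg_one_mul]
    exact ⟨P, fun x y => by rw [← hh, hP]⟩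

theorem lastCofactor_mul_left {R : Type*} [CommRing R] {k : ℕ} (c : R) (A : Fin k → Fin (k + 1) → R)
    (j : Fin (k + 1)) :
    lastCofactor (fun l j' => c * A l j') j = c ^ k * lastCofactor A j := by
  have : (Matrix.of fun l j' : Fin k => c * A l (j.succAbove j')) =
      c • (Matrix.of fun l j' : Fin k => A l (j.succAbove j')) := by
    ext l j'
    simp
  rw [lastCofactor, lastCofactor, this, Matrix.det_smul, Fintype.card_fin]
  ring

/-- The order of factors matters: ℳ₁ acts first, on its eigenvector p_n, and only then does 𝒟₁ act
diagonally on the e_i. -/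
theorem symbolOp_opM_jacobi {α β : ℝ} (hα : ∀ m : ℕ, α + 1 + (m : ℝ) ≠ 0)
    (hs : ∀ m : ℕ, α + β + 1 + (m : ℝ) ≠ 0) (P : ℝ[X][X]) (n : ℕ) :
    symbolOp (opM α β) P (jacobi α β n) = ∑ i ∈ Finset.range (n + 1),
      (P.evalEval (i : ℝ) (lam (α + β + 1) n) * jacobiWeight (α + β + 1) n i) • shiftBasis α i := by
  rw [symbolOp_apply]
  have h : ∀ b : ℕ, (opM α β ^ b) (jacobi α β n) = lam (α + β + 1) n ^ b • jacobi α β n := by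
    intro b
    have := aeval_opM_jacobi α β n (X ^ b)
    simpa using this
  simp only [h, map_smul]
  rw [jacobi_eq_sum hα hs]
  simp only [map_sum, map_smul, aeval_opD₁_shiftBasis, Finset.smul_sum, smul_smul]
  rw [Finset.sum_comm]
  refine Finset.sum_congr rfl fun i _ => ?_
  rw [← Finset.sum_smul]
  congr 1
  rw [evalEval, eval_eq_sum (p := P), Polynomial.sum, eval_finsetSum, Finset.sum_mul]
  refine Finset.sum_congr rfl fun b _ => ?_
  rw [eval_mul, eval_pow, eval_C]
  ring

theorem neg_one_zpow_sub (n j : ℕ) : (-1 : ℝ) ^ ((n : ℤ) - (j : ℤ)) = (-1) ^ n * (-1) ^ j := by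
  rw [zpow_sub₀ (by norm_num), zpow_natCast, zpow_natCast, div_eq_mul_inv, ← inv_pow]
  norm_num

theorem exists_isBHat {α β : ℝ} {k : ℕ} (hα : ∀ m : ℕ, α + 1 + (m : ℝ) ≠ 0)
    (hαβ : ∀ m : ℕ, α + (β - k) + 1 + (m : ℝ) ≠ 0) (hαβ' : ∀ m : ℕ, α + β + 1 + (m : ℝ) ≠ 0)
    {ψ : Fin k → ℤ → ℝ} {g : Fin k → ℝ[X]}
    (hg : ∀ l, ∀ n : ℤ, ψ l n = (-1 : ℝ) ^ n * (g l).eval (lam (α + β + 1) (n : ℝ))) :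
    ∃ B, IsBHat α β ψ B := by
  obtain ⟨P, hP⟩ := exists_symbol (α + (β - k) + 1) g
  refine ⟨(poch (α + (β - k) + 1) k)⁻¹ • symbolOp (opM α (β - k)) P,
    Subalgebra.smul_mem _ (symbolOp_mem_algD (opM_mem_algD _ _) P) _, fun n => ?_⟩
  have hpoch := poch_ne_zero hαβ k
  rw [LinearMap.smul_apply, symbolOp_opM_jacobi hα hαβ, qPoly_eq_sum]
  set s := α + (β - k) + 1 with hs
  have hs' : α + β + 1 = s + k := by rw [hs]; ring
  have hexp := fun j : Fin (k + 1) =>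
    jacobiZ_eq_sum hα hαβ' (N := n + 1) (n := (n : ℤ) - ((j : ℕ) : ℤ)) (by push_cast; omega)
  simp only [hexp, Finset.smul_sum, smul_smul]
  rw [Finset.sum_comm]
  refine Finset.sum_congr rfl fun i hi => ?_
  rw [← Finset.sum_smul]
  congr 1
  have hin : i ≤ n := Nat.lt_succ_iff.mp (Finset.mem_range.mp hi)
  -- The sign (-1)^n leaves each of the k rows, which gives the (-1)^{nk} of `cFactor`.
  have hA : (fun (l : Fin k) (j : Fin (k + 1)) => ψ l ((n : ℤ) - ((j : ℕ) : ℤ))) =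
      fun l (j : Fin (k + 1)) => (-1) ^ n * ((-1) ^ (j : ℕ) * (g l).eval (lam (s + k) ((n : ℝ) - (j : ℕ)))) := by
    ext l j
    rw [hg, neg_one_zpow_sub, hs']
    push_cast
    ring
  have hdet := hP i n
  rw [symbolMatrix, det_appendRow] at hdet
  have hc : cFactor (α + β) n k =
      (-1) ^ (n * k) * (if k % 4 = 0 ∨ k % 4 = 3 then 1 else 2 * (n : ℝ) + s) := by
    rw [cFactor, hs]
    split_ifs <;> ring
  rw [hA, hc, hs', mul_comm (poch s k)⁻¹, ← mul_assoc, eq_mul_inv_iff_mul_eq₀ hpoch, Finset.sum_mul]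
  rw [show ∀ a b c d : ℝ, a * b * (c * d) = a * (b * c) * d by intros; ring, ← hdet,
    Finset.mul_sum, Finset.sum_mul]
  refine Finset.sum_congr rfl fun j _ => ?_
  rw [lastCofactor_mul_left, ← pow_mul, mul_assoc, mul_comm _ (poch s k),
    poch_mul_jacobiWeight s k n i j hin]
  ring

/-! ### The discrete Wronskian as a function of a real variable -/

/-- The matrix with entries `g_l(λ_{x-j}^s)`. -/
def shiftMatrix (s : ℝ) {k : ℕ} (g : Fin k → ℝ[X]) (x : ℝ) : Matrix (Fin k) (Fin k) ℝ :=
  Matrix.of fun l j => (g l).eval (lam s (x - (j : ℕ)))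

theorem cast_val_rev {k : ℕ} (j : Fin k) :
    (((Fin.rev j : Fin k) : ℕ) : ℝ) = k - 1 - (j : ℕ) := by
  have h : ((Fin.rev j : Fin k) : ℕ) + (j : ℕ) + 1 = k := by rw [Fin.val_rev]; omega
  have := congrArg (Nat.cast (R := ℝ)) h
  push_cast at this
  linarith

theorem lam_reflect (s x : ℝ) : lam s (-x - s) = lam s x := by
  simp only [lam]; ring

theorem shiftMatrix_reflect (s : ℝ) {k : ℕ} (g : Fin k → ℝ[X]) (x : ℝ) :
    shiftMatrix s g (-x - s + (k - 1)) = (shiftMatrix s g x).submatrix id Fin.revPerm := by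
  ext l j
  simp only [shiftMatrix, Matrix.of_apply, Matrix.submatrix_apply, id, Fin.revPerm_apply]
  rw [cast_val_rev, ← lam_reflect]
  congr 2
  ring

/-- The determinant of the shift matrix with one column replaced. -/
def replacedDet (s : ℝ) {k : ℕ} (g : Fin k → ℝ[X]) (b : Fin k → ℝ) (x : ℝ) (c : Fin k) : ℝ :=
  ((shiftMatrix s g x).updateCol c b).det

/-- The sign by which the determinant of `shiftMatrix` changes under reflection. -/
def revSign (k : ℕ) : ℝ := ((Equiv.Perm.sign (Fin.revPerm : Equiv.Perm (Fin k)) : ℤ) : ℝ)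

theorem revSign_mul_self (k : ℕ) : revSign k * revSign k = 1 := by
  rw [revSign, ← Int.cast_mul, ← Units.val_mul, Int.units_mul_self]
  simp

theorem det_shiftMatrix_reflect (s : ℝ) {k : ℕ} (g : Fin k → ℝ[X]) (x : ℝ) :
    (shiftMatrix s g (-x - s + (k - 1))).det = revSign k * (shiftMatrix s g x).det := by
  rw [shiftMatrix_reflect, Matrix.det_permute', revSign]

theorem replacedDet_reflect (s : ℝ) {k : ℕ} (g : Fin k → ℝ[X]) (b : Fin k → ℝ) (x : ℝ)
    (c : Fin k) :
    replacedDet s g b (-x - s + (k - 1)) c = revSign k * replacedDet s g b x (Fin.rev c) := by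
  rw [replacedDet, shiftMatrix_reflect, replacedDet, revSign, ← Matrix.det_permute']
  congr 1
  ext l j
  simp only [Matrix.submatrix_apply, id, Fin.revPerm_apply, Matrix.updateCol_apply]
  by_cases h : j = c
  · simp [h]
  · rw [if_neg h, if_neg (by simpa using h)]

theorem sum_mul_replacedDet_single (s : ℝ) {k : ℕ} (g : Fin k → ℝ[X]) (b : Fin k → ℝ) (x : ℝ)
    (c : Fin k) : ∑ l, b l * replacedDet s g (Pi.single l 1) x c = replacedDet s g b x c := by
  simp only [replacedDet, ← Matrix.cramer_apply]
  have h : b = ∑ l, b l • Pi.single l (1 : ℝ) := by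
    ext i
    simp [Finset.sum_apply, Pi.single_apply]
  conv_rhs => rw [h, map_sum, Finset.sum_apply]
  simp

/-- The vector of the `g_l(λ_v^s)`. -/
def lamVec (s : ℝ) {k : ℕ} (g : Fin k → ℝ[X]) (v : ℝ) : Fin k → ℝ := fun l => (g l).eval (lam s v)

theorem replacedDet_lamVec_self (s : ℝ) {k : ℕ} (g : Fin k → ℝ[X]) (v : ℝ) (c : Fin k) :
    replacedDet s g (lamVec s g v) (v + (c : ℕ)) c = (shiftMatrix s g (v + (c : ℕ))).det := by
  rw [replacedDet]
  congr 1
  ext l j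
  rw [Matrix.updateCol_apply]
  split_ifs with h
  · simp [shiftMatrix, lamVec, h]
  · rfl

/-- The inserted column already stands at position c' = x - v, so two columns coincide. -/
theorem replacedDet_lamVec_of_ne (s : ℝ) {k : ℕ} (g : Fin k → ℝ[X]) {v x : ℝ} {c : Fin k} (c' : ℕ)
    (hc' : c' < k) (hv : v + c' = x) (hne : c' ≠ c) : replacedDet s g (lamVec s g v) x c = 0 := by
  have hne' : (⟨c', hc'⟩ : Fin k) ≠ c := fun h => hne (by rw [← h])
  refine Matrix.det_zero_of_column_eq hne' fun l => ?_
  rw [Matrix.updateCol_self, Matrix.updateCol_ne hne']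
  simp [shiftMatrix, lamVec, ← hv]

theorem shiftMatrix_mem_polyFun (s : ℝ) {k : ℕ} (g : Fin k → ℝ[X]) (a : ℝ) (l j : Fin k) :
    (fun _ y => shiftMatrix s g (y + a) l j) ∈ polyFun :=
  eval_mem_polyFun _ (lam_mem_polyFun _ (sub_mem (add_mem snd_mem_polyFun (const_mem_polyFun a))
    (const_mem_polyFun _)))

theorem det_shiftMatrix_mem_polyFun (s : ℝ) {k : ℕ} (g : Fin k → ℝ[X]) (a : ℝ) :
    (fun _ y => (shiftMatrix s g (y + a)).det) ∈ polyFun :=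
  det_mem_polyFun (A := fun i j _ y => shiftMatrix s g (y + a) i j) (shiftMatrix_mem_polyFun s g a)

theorem replacedDet_mem_polyFun (s : ℝ) {k : ℕ} (g : Fin k → ℝ[X]) (b : Fin k → ℝ) (a : ℝ)
    (c : Fin k) : (fun _ y => replacedDet s g b (y + a) c) ∈ polyFun := by
  refine det_mem_polyFun (A := fun i j _ y => (shiftMatrix s g (y + a)).updateCol c b i j)
    fun i j => ?_
  by_cases h : j = c
  · simp only [Matrix.updateCol_apply, if_pos h]
    exact const_mem_polyFun _
  · simp only [Matrix.updateCol_apply, if_neg h]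
    exact shiftMatrix_mem_polyFun s g a i j

/-! ### The bispectral operators -/

/-- The eigenvalue `f(λ_{x-k/2}^s)`. -/
def eigenvalue (s : ℝ) (k : ℕ) (f : ℝ[X]) (x : ℝ) : ℝ := f.eval (lam s (x - k / 2))

theorem eigenvalue_reflect (s : ℝ) (k : ℕ) (f : ℝ[X]) (x : ℝ) :
    eigenvalue s k f (-x - s + k) = eigenvalue s k f x := by
  rw [eigenvalue, eigenvalue, ← lam_reflect]
  congr 2
  ring

theorem eigenvalue_mem_polyFun (s : ℝ) (k : ℕ) (f : ℝ[X]) (a : ℝ) :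
    (fun _ y => eigenvalue s k f (y + a)) ∈ polyFun :=
  eval_mem_polyFun f (lam_mem_polyFun _ (sub_mem (add_mem snd_mem_polyFun (const_mem_polyFun a))
    (const_mem_polyFun _)))

theorem eq_of_polyFun_of_int {F G : ℝ → ℝ} (hF : (fun _ y => F y) ∈ polyFun)
    (hG : (fun _ y => G y) ∈ polyFun) (h : ∀ n : ℤ, F n = G n) (x : ℝ) : F x = G x := by
  obtain ⟨p, hp⟩ := exists_eval_of_mem_polyFun hF
  obtain ⟨q, hq⟩ := exists_eval_of_mem_polyFun hG
  have : p = q := by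
    refine Polynomial.eq_of_infinite_eval_eq p q ((Set.infinite_range_of_injective
      (f := fun m : ℤ => (m : ℝ)) Int.cast_injective).mono ?_)
    rintro _ ⟨m, rfl⟩
    change p.eval _ = q.eval _
    rw [hp, hq, h]
  rw [← hp, ← hq, this]

theorem eigenvalue_sub_eq {s : ℝ} {k : ℕ} {g : Fin k → ℝ[X]} {f r : ℝ[X]}
    (h : ∀ n : ℤ, eigenvalue s k f n - eigenvalue s k f ((n : ℝ) - 1) =
      r.eval (n : ℝ) * (shiftMatrix s g ((n : ℝ) - 1)).det) (x : ℝ) :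
    eigenvalue s k f x - eigenvalue s k f (x - 1) =
      r.eval x * (shiftMatrix s g (x - 1)).det := by
  refine eq_of_polyFun_of_int (F := fun x => eigenvalue s k f x - eigenvalue s k f (x - 1))
    (G := fun x => r.eval x * (shiftMatrix s g (x - 1)).det) ?_ ?_ h x
  · have := sub_mem (eigenvalue_mem_polyFun s k f 0) (eigenvalue_mem_polyFun s k f (-1))
    simp only [add_zero] at this
    exact this
  · exact mul_mem (eval_mem_polyFun r snd_mem_polyFun) (det_shiftMatrix_mem_polyFun s g (-1))

/-- Reflection swaps the two eigenvalues in the difference and multiplies the determinant by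
`revSign k`; the determinant is a nonzero polynomial and can be cancelled. -/
theorem eval_reflect_of_eigenvalue {s : ℝ} {k : ℕ} {g : Fin k → ℝ[X]} {f r : ℝ[X]}
    (hr : ∀ x, eigenvalue s k f x - eigenvalue s k f (x - 1) =
      r.eval x * (shiftMatrix s g (x - 1)).det) (hτ : ∃ x, (shiftMatrix s g x).det ≠ 0) (x : ℝ) :
    r.eval (-x - s + (k + 1)) = -revSign k * r.eval x := by
  obtain ⟨D, hD⟩ := exists_eval_of_mem_polyFun (det_shiftMatrix_mem_polyFun s g (-1))
  have hD0 : D ≠ 0 := by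
    rintro rfl
    obtain ⟨x, hx⟩ := hτ
    have := hD (x + 1)
    rw [add_neg_cancel_right, eval_zero] at this
    exact hx this.symm
  have h : (C (revSign k) * r.comp (-X - C s + C ((k : ℝ) + 1)) + r) * D = 0 := by
    refine Polynomial.funext fun y => ?_
    simp only [eval_mul, eval_add, eval_sub, eval_neg, eval_X, eval_C, eval_comp, eval_zero, hD]
    have h1 := hr y
    have h2 := hr (-y - s + (k + 1))
    rw [show -y - s + ((k : ℝ) + 1) - 1 = -(y - 1) - s + (k - 1) by ring,
      det_shiftMatrix_reflect,
      show -(y - 1) - s + ((k : ℝ) - 1) = -y - s + k by ring, eigenvalue_reflect,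
      show -y - s + ((k : ℝ) + 1) = -(y - 1) - s + k by ring, eigenvalue_reflect] at h2
    rw [← sub_eq_add_neg, show -y - s + ((k : ℝ) + 1) = -(y - 1) - s + k by ring]
    linear_combination -h1 - h2
  have h0 := (mul_eq_zero.mp h).resolve_right hD0
  have := congrArg (eval x) h0
  simp only [eval_mul, eval_add, eval_sub, eval_neg, eval_X, eval_C, eval_comp, eval_zero] at this
  linear_combination revSign k * this - eval (-x - s + (k + 1)) r * revSign_mul_self k

/-- The coefficients in the expansion of the action of the bispectral operator on the Jacobi
polynomials. -/
def weightCoeff (s : ℝ) {k : ℕ} (g : Fin k → ℝ[X]) (r : ℝ[X]) (b : Fin k → ℝ) (S : Finset (Fin k))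
    (u : ℝ) : ℝ :=
  -∑ c ∈ S, r.eval (u + (c : ℕ) + 1) * replacedDet s g b (u + (c : ℕ)) c

theorem weightCoeff_mem_polyFun (s : ℝ) {k : ℕ} (g : Fin k → ℝ[X]) (r : ℝ[X]) (b : Fin k → ℝ)
    (S : Finset (Fin k)) : (fun _ y => weightCoeff s g r b S y) ∈ polyFun := by
  have : (fun _ y => weightCoeff s g r b S y) = -∑ c ∈ S, fun (_ : ℝ) (y : ℝ) =>
      r.eval (y + (c : ℕ) + 1) * replacedDet s g b (y + (c : ℕ)) c := by
    ext x y
    simp [weightCoeff, Finset.sum_apply]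
  rw [this]
  exact neg_mem (sum_mem fun c _ => mul_mem (eval_mem_polyFun _ (add_mem (add_mem snd_mem_polyFun
    (const_mem_polyFun _)) (const_mem_polyFun _))) (replacedDet_mem_polyFun s g b _ c))

theorem sum_mul_weightCoeff (s : ℝ) {k : ℕ} (g : Fin k → ℝ[X]) (r : ℝ[X]) (b : Fin k → ℝ)
    (S : Finset (Fin k)) (u : ℝ) :
    ∑ l, b l * weightCoeff s g r (Pi.single l 1) S u = weightCoeff s g r b S u := by
  simp only [weightCoeff, mul_neg, Finset.sum_neg_distrib, Finset.mul_sum]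
  rw [Finset.sum_comm]
  congr 1
  refine Finset.sum_congr rfl fun c _ => ?_
  rw [← sum_mul_replacedDet_single, Finset.mul_sum]
  exact Finset.sum_congr rfl fun l _ => by ring

/-- Reflection reverses the columns; the two factors `revSign k`, from r and from the determinant,
cancel and leave the minus sign of r. Oddness supplies the factor 2u+s. -/
theorem weightCoeff_reflect {s : ℝ} {k : ℕ} {g : Fin k → ℝ[X]} {r : ℝ[X]}
    (hr : ∀ x, r.eval (-x - s + (k + 1)) = -revSign k * r.eval x) (b : Fin k → ℝ) (u : ℝ) :
    weightCoeff s g r b Finset.univ (-u - s) = -weightCoeff s g r b Finset.univ u := by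
  rw [weightCoeff, weightCoeff, neg_neg, ← Equiv.sum_comp Fin.revPerm, ← Finset.sum_neg_distrib]
  refine Finset.sum_congr rfl fun c _ => ?_
  rw [Fin.revPerm_apply, cast_val_rev,
    show -u - s + ((k : ℝ) - 1 - (c : ℕ)) + 1 = -(u + (c : ℕ) + 1) - s + (k + 1) by ring, hr,
    show -u - s + ((k : ℝ) - 1 - (c : ℕ)) = -(u + (c : ℕ)) - s + (k - 1) by ring,
    replacedDet_reflect, Fin.rev_rev]
  linear_combination (r.eval (u + (c : ℕ) + 1) * replacedDet s g b (u + (c : ℕ)) c) *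
    revSign_mul_self k

/-! ### Truncated column sums: coincidences and telescoping. -/

/-- The columns that are met before `n` when one starts at `u`. -/
def columnsBelow (k : ℕ) (u n : ℤ) : Finset (Fin k) := Finset.univ.filter fun c => u + (c : ℕ) < n

theorem weightCoeff_columnsBelow_of_lt (s : ℝ) {k : ℕ} (g : Fin k → ℝ[X]) (r : ℝ[X]) {u v n : ℤ}
    (huv : u < v) (hvn : v ≤ n) :
    weightCoeff s g r (lamVec s g v) (columnsBelow k u n) u =
      weightCoeff s g r (lamVec s g v) Finset.univ u := by
  rw [weightCoeff, weightCoeff]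
  congr 1
  refine Finset.sum_subset (Finset.subset_univ _) fun c _ hc => ?_
  have hc : n ≤ u + (c : ℕ) := by simpa [columnsBelow] using hc
  -- An omitted column has u + c ≥ n ≥ v, so the point v belongs to the window ending at u + c and
  -- the determinant vanishes.
  obtain ⟨c', hc'⟩ := Int.eq_ofNat_of_zero_le (show 0 ≤ u + (c : ℕ) - v by omega)
  rw [replacedDet_lamVec_of_ne s g c' (by omega) ?_ (by omega), mul_zero]
  rw [← Int.cast_natCast (R := ℝ) c', ← hc']
  push_cast
  ring

theorem weightCoeff_columnsBelow_of_gt (s : ℝ) {k : ℕ} (g : Fin k → ℝ[X]) (r : ℝ[X]) {u v n : ℤ}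
    (huv : v < u) (hvn : n - v ≤ k) :
    weightCoeff s g r (lamVec s g v) (columnsBelow k u n) u = 0 := by
  rw [weightCoeff, neg_eq_zero]
  refine Finset.sum_eq_zero fun c hc => ?_
  have hc : u + (c : ℕ) < n := by simpa [columnsBelow] using hc
  obtain ⟨c', hc'⟩ := Int.eq_ofNat_of_zero_le (show 0 ≤ u + (c : ℕ) - v by omega)
  rw [replacedDet_lamVec_of_ne s g c' (by omega) ?_ (by omega), mul_zero]
  rw [← Int.cast_natCast (R := ℝ) c', ← hc']
  push_cast
  ring

/-- For u = v the replacement changes nothing, so each term is r times the full determinant, a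
difference of consecutive eigenvalues. -/
theorem weightCoeff_columnsBelow_self {s : ℝ} {k : ℕ} {g : Fin k → ℝ[X]} {f r : ℝ[X]}
    (hr : ∀ x, eigenvalue s k f x - eigenvalue s k f (x - 1) =
      r.eval x * (shiftMatrix s g (x - 1)).det) (v : ℤ) {j : ℕ} (hj : j ≤ k) :
    weightCoeff s g r (lamVec s g v) (columnsBelow k v (v + j)) v =
      eigenvalue s k f v - eigenvalue s k f (v + j) := by
  have h : ∑ c ∈ columnsBelow k v (v + j), r.eval ((v : ℝ) + (c : ℕ) + 1) *
      replacedDet s g (lamVec s g v) (v + (c : ℕ)) c =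
      ∑ c ∈ Finset.range j, (eigenvalue s k f (v + (c + 1 : ℕ)) - eigenvalue s k f (v + c)) := by
    refine Finset.sum_bij (fun c _ => (c : ℕ)) ?_ ?_ ?_ ?_
    · intro c hc
      simpa [columnsBelow] using hc
    · intro c _ c' _ h
      exact Fin.ext h
    · intro c hc
      rw [Finset.mem_range] at hc
      exact ⟨⟨c, by omega⟩, by simpa [columnsBelow] using hc, rfl⟩
    · intro c _
      rw [replacedDet_lamVec_self]
      have := hr (v + (c : ℕ) + 1)
      rw [add_sub_cancel_right] at this
      rw [← this]
      push_cast
      rw [add_assoc]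
  rw [weightCoeff, h, Finset.sum_range_sub (fun c : ℕ => eigenvalue s k f (v + c))]
  simp

theorem weightCoeff_univ_self {s : ℝ} {k : ℕ} {g : Fin k → ℝ[X]} {f r : ℝ[X]}
    (hr : ∀ x, eigenvalue s k f x - eigenvalue s k f (x - 1) =
      r.eval x * (shiftMatrix s g (x - 1)).det) (v : ℤ) :
    weightCoeff s g r (lamVec s g v) Finset.univ v =
      eigenvalue s k f v - eigenvalue s k f (v + k) := by
  rw [← weightCoeff_columnsBelow_self hr v le_rfl]
  congr 1
  ext c
  simp [columnsBelow]

/-- The operator `h(ℳ₁) + ∑_l P_l(ℳ₁) (𝒟₁ + s/2) g_l(ℳ₁)` with `s = α + β + 1`. -/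
def bispectralOp (α β : ℝ) {k : ℕ} (h : ℝ[X]) (P g : Fin k → ℝ[X]) : Module.End ℝ ℝ[X] :=
  aeval (opM α β) h + ∑ l, aeval (opM α β) (P l) *
    (opD₁ + algebraMap ℝ (Module.End ℝ ℝ[X]) ((α + β + 1) / 2)) * aeval (opM α β) (g l)

theorem bispectralOp_mem_algD (α β : ℝ) {k : ℕ} (h : ℝ[X]) (P g : Fin k → ℝ[X]) :
    bispectralOp α β h P g ∈ algD α := by
  have hM := opM_mem_algD α β
  exact add_mem (aeval_mem_algD hM h) (sum_mem fun l _ => mul_mem (mul_mem (aeval_mem_algD hM _)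
    (add_mem (opD₁_mem_algD α) (Subalgebra.algebraMap_mem _ _))) (aeval_mem_algD hM _))

theorem bispectralOp_jacobi {α β : ℝ} (hα : ∀ m : ℕ, α + 1 + (m : ℝ) ≠ 0)
    (hs : ∀ m : ℕ, α + β + 1 + (m : ℝ) ≠ 0) {k : ℕ} {h : ℝ[X]} {P g : Fin k → ℝ[X]} {f r : ℝ[X]}
    (hh : ∀ y, (eigenvalue (α + β + 1) k f y + eigenvalue (α + β + 1) k f (y + k)) / 2 =
      h.eval (lam (α + β + 1) y))
    (hP : ∀ l y, weightCoeff (α + β + 1) g r (Pi.single l 1) Finset.univ y =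
      (2 * y + (α + β + 1)) * (P l).eval (lam (α + β + 1) y))
    (hr : ∀ x, eigenvalue (α + β + 1) k f x - eigenvalue (α + β + 1) k f (x - 1) =
      r.eval x * (shiftMatrix (α + β + 1) g (x - 1)).det) (n : ℕ) :
    bispectralOp α β h P g (jacobi α β n) =
      eigenvalue (α + β + 1) k f n • jacobi α β n + ∑ u ∈ Finset.range n, ((-1) ^ n * (-1) ^ u *
        weightCoeff (α + β + 1) g r (lamVec (α + β + 1) g n) Finset.univ u) • jacobi α β u := by
  set s := α + β + 1 with hs'
  have h1 : (opD₁ + algebraMap ℝ (Module.End ℝ ℝ[X]) (s / 2)) (jacobi α β n) =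
      ((n : ℝ) + s / 2) • jacobi α β n +
        ∑ u ∈ Finset.range n, ((-1) ^ n * ((-1) ^ u * (2 * (u : ℝ) + s))) • jacobi α β u := by
    have h2 := sum_jacobi_eq hα hs n
    simp only [mul_smul ((-1 : ℝ) ^ n), ← Finset.smul_sum]
    rw [hs', h2, smul_smul, ← mul_pow]
    simp only [LinearMap.add_apply, Module.algebraMap_end_apply]
    simp only [neg_mul_neg, one_mul, one_pow, one_smul]
    module
  have h3 : ∀ l, (aeval (opM α β) (P l) * (opD₁ + algebraMap ℝ (Module.End ℝ ℝ[X]) (s / 2)) *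
      aeval (opM α β) (g l)) (jacobi α β n) =
      (lamVec s g n l * weightCoeff s g r (Pi.single l 1) Finset.univ n / 2) • jacobi α β n +
        ∑ u ∈ Finset.range n, ((-1) ^ n * (-1) ^ u *
          (lamVec s g n l * weightCoeff s g r (Pi.single l 1) Finset.univ u)) • jacobi α β u := by
    intro l
    rw [Module.End.mul_apply, Module.End.mul_apply, aeval_opM_jacobi, map_smul, h1, map_smul,
      map_add, map_smul, map_sum, aeval_opM_jacobi, smul_add, smul_smul, smul_smul, Finset.smul_sum]
    congr 1
    · congr 1
      rw [hP, lamVec]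
      ring
    · refine Finset.sum_congr rfl fun u _ => ?_
      rw [map_smul, aeval_opM_jacobi, smul_smul, smul_smul, hP, lamVec]
      congr 1
      ring
  rw [bispectralOp, ← hs', LinearMap.add_apply, LinearMap.sum_apply, aeval_opM_jacobi,
    Finset.sum_congr rfl (fun l _ => h3 l), Finset.sum_add_distrib, ← add_assoc, ← Finset.sum_smul,
    ← add_smul, ← Finset.sum_div, sum_mul_weightCoeff, Finset.sum_comm]
  congr 1
  -- On the diagonal the mean of the eigenvalues at n and n+k, plus half their difference, is the
  -- eigenvalue at n.
  · congr 1
    have h4 := weightCoeff_univ_self hr n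
    rw [Int.cast_natCast] at h4
    rw [h4, ← hh]
    ring
  · refine Finset.sum_congr rfl fun u _ => ?_
    rw [← Finset.sum_smul, ← Finset.mul_sum, sum_mul_weightCoeff]

/-- With v = n - j, G_l is the sum over u < n of the truncated weights. In ∑_l ψ^{(l)}_v G_l the
terms u > v vanish, those with u < v reproduce the lower part of B p_v, and u = v turns the
eigenvalue at v into the one at n. For v < 0 only vanishing terms u > v occur. -/
theorem bispectralOp_jacobiZ {α β : ℝ} {k : ℕ} {B : Module.End ℝ ℝ[X]}
    {g : Fin k → ℝ[X]} {f r : ℝ[X]} {ψ : Fin k → ℤ → ℝ}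
    (hg : ∀ l, ∀ n : ℤ, ψ l n = (-1 : ℝ) ^ n * (g l).eval (lam (α + β + 1) (n : ℝ)))
    (hr : ∀ x, eigenvalue (α + β + 1) k f x - eigenvalue (α + β + 1) k f (x - 1) =
      r.eval x * (shiftMatrix (α + β + 1) g (x - 1)).det)
    (hB : ∀ n : ℕ, B (jacobi α β n) =
      eigenvalue (α + β + 1) k f n • jacobi α β n + ∑ u ∈ Finset.range n, ((-1) ^ n * (-1) ^ u *
        weightCoeff (α + β + 1) g r (lamVec (α + β + 1) g n) Finset.univ u) • jacobi α β u)
    (n : ℕ) : ∃ G : Fin k → ℝ[X], ∀ j : ℕ, j ≤ k →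
      B (jacobiZ α β (n - j)) = eigenvalue (α + β + 1) k f n • jacobiZ α β (n - j) +
        ∑ l, ψ l (n - j) • G l := by
  set s := α + β + 1
  refine ⟨fun l => ∑ u ∈ Finset.range n,
    ((-1) ^ u * weightCoeff s g r (Pi.single l 1) (columnsBelow k u n) u) • jacobi α β u,
    fun j hj => ?_⟩
  have h1 : ∀ v : ℤ, ∑ l, ψ l v • (∑ u ∈ Finset.range n,
      ((-1) ^ u * weightCoeff s g r (Pi.single l 1) (columnsBelow k u n) u) • jacobi α β u) =
      ∑ u ∈ Finset.range n, ((-1) ^ v * (-1) ^ u *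
        weightCoeff s g r (lamVec s g v) (columnsBelow k u n) u) • jacobi α β u := by
    intro v
    simp only [Finset.smul_sum, smul_smul]
    rw [Finset.sum_comm]
    refine Finset.sum_congr rfl fun u _ => ?_
    rw [← Finset.sum_smul, ← sum_mul_weightCoeff, Finset.mul_sum]
    congr 1
    refine Finset.sum_congr rfl fun l _ => ?_
    rw [hg, lamVec]
    ring
  rw [h1]
  have hgt : ∀ u : ℕ, (n : ℤ) - j < u →
      weightCoeff s g r (lamVec s g (((n : ℤ) - j : ℤ) : ℝ)) (columnsBelow k u n) u = 0 := by
    intro u hu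
    have := weightCoeff_columnsBelow_of_gt s g r hu (n := n) (by omega)
    rwa [Int.cast_natCast] at this
  rcases lt_or_ge n j with hnj | hnj
  · rw [jacobiZ_of_neg α β (by omega), map_zero, smul_zero, zero_add, Finset.sum_eq_zero]
    intro u _
    rw [hgt u (by omega), mul_zero, zero_smul]
  · obtain ⟨m, rfl⟩ := Nat.exists_eq_add_of_le' hnj
    have hm : (((m + j : ℕ) : ℤ) - (j : ℤ)) = m := by push_cast; ring
    rw [hm] at hgt ⊢
    have hlt : ∀ u : ℕ, u < m →
        weightCoeff s g r (lamVec s g ((m : ℤ) : ℝ)) (columnsBelow k u ((m + j : ℕ) : ℤ)) u =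
          weightCoeff s g r (lamVec s g (m : ℝ)) Finset.univ u := by
      intro u hu
      have := weightCoeff_columnsBelow_of_lt s g r (u := u) (v := m) (n := ((m + j : ℕ) : ℤ))
        (by omega) (by omega)
      simpa using this
    have hself : weightCoeff s g r (lamVec s g ((m : ℤ) : ℝ))
        (columnsBelow k m ((m + j : ℕ) : ℤ)) m =
          eigenvalue s k f m - eigenvalue s k f ((m + j : ℕ) : ℝ) := by
      have := weightCoeff_columnsBelow_self hr m hj
      push_cast at this ⊢
      exact this
    rw [jacobiZ_natCast, hB, zpow_natCast, Finset.sum_range_add]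
    have h2 : ∑ u ∈ Finset.range m, ((-1 : ℝ) ^ m * (-1) ^ u *
        weightCoeff s g r (lamVec s g ((m : ℤ) : ℝ)) (columnsBelow k u ((m + j : ℕ) : ℤ)) u) •
          jacobi α β u = ∑ u ∈ Finset.range m, ((-1 : ℝ) ^ m * (-1) ^ u *
        weightCoeff s g r (lamVec s g (m : ℝ)) Finset.univ u) • jacobi α β u :=
      Finset.sum_congr rfl fun u hu => by rw [hlt u (Finset.mem_range.mp hu)]
    rw [h2]
    rcases j with _ | j
    · simp
    · have h3 : ∀ u ∈ Finset.range j, ((-1 : ℝ) ^ m * (-1) ^ (m + (u + 1)) *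
          weightCoeff s g r (lamVec s g ((m : ℤ) : ℝ))
            (columnsBelow k ((m + (u + 1) : ℕ) : ℤ) ((m + (j + 1) : ℕ) : ℤ))
              ((m + (u + 1) : ℕ) : ℝ)) • jacobi α β (m + (u + 1)) = 0 := by
        intro u _
        rw [hgt (m + (u + 1)) (by push_cast; omega), mul_zero, zero_smul]
      rw [Finset.sum_range_succ' _ j, Finset.sum_eq_zero h3, zero_add, add_zero, hself, ← mul_pow,
        neg_mul_neg, one_mul, one_pow]
      module

theorem tau_eq {s : ℝ} {k : ℕ} {g : Fin k → ℝ[X]} {ψ : Fin k → ℤ → ℝ}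
    (hg : ∀ l, ∀ n : ℤ, ψ l n = (-1 : ℝ) ^ n * (g l).eval (lam s (n : ℝ))) (n : ℤ) :
    tau ψ n = (shiftMatrix s g n).det := by
  rw [tau, discreteWronskian]
  congr 1
  ext l j
  simp only [Matrix.of_apply, shiftMatrix]
  rw [hg, ← mul_assoc, ← mul_zpow]
  simp

theorem exists_isBf {α β : ℝ} {k : ℕ} (hα : ∀ m : ℕ, α + 1 + (m : ℝ) ≠ 0)
    (hs : ∀ m : ℕ, α + β + 1 + (m : ℝ) ≠ 0) {ψ : Fin k → ℤ → ℝ} {g : Fin k → ℝ[X]}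
    (hg : ∀ l, ∀ n : ℤ, ψ l n = (-1 : ℝ) ^ n * (g l).eval (lam (α + β + 1) (n : ℝ)))
    (hτ : ∃ n : ℤ, tau ψ n ≠ 0) {f : ℝ[X]} (hf : f ∈ krallAlgebra α β ψ) :
    ∃ B, IsBf α β ψ f B := by
  obtain ⟨r, hr⟩ := hf
  replace hr := eigenvalue_sub_eq (s := α + β + 1) (g := g) (f := f) (r := r) (fun n => by
    have := hr n
    rw [tau_eq hg] at this
    push_cast at this
    rw [← this, eigenvalue, eigenvalue]
    congr 3
    ring)
  have hτ' : ∃ x, (shiftMatrix (α + β + 1) g x).det ≠ 0 := by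
    obtain ⟨n, hn⟩ := hτ
    exact ⟨n, by rwa [tau_eq hg] at hn⟩
  have hrr := eval_reflect_of_eigenvalue hr hτ'
  -- The reflection y ↦ -y - s interchanges the eigenvalues at y and y + k, so their mean is a
  -- polynomial in λ_y.
  obtain ⟨h, hh⟩ := exists_lam_of_mem_polyFun_of_symm (s := α + β + 1)
    (F := fun y => (eigenvalue (α + β + 1) k f y + eigenvalue (α + β + 1) k f (y + k)) / 2) (by
      have := Subalgebra.smul_mem _ (add_mem (eigenvalue_mem_polyFun (α + β + 1) k f 0)
        (eigenvalue_mem_polyFun (α + β + 1) k f k)) (1 / 2)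
      refine cast ?_ this
      congr 1
      ext x y
      simp
      ring) (fun y => by
      have h1 := eigenvalue_reflect (α + β + 1) k f y
      have h2 := eigenvalue_reflect (α + β + 1) k f (y + k)
      rw [show -(y + k) - (α + β + 1) + k = -y - (α + β + 1) by ring] at h2
      simp only [h1, h2]
      rw [add_comm])
  choose P hP using fun l : Fin k => exists_lam_of_mem_polyFun_of_antisymm
    (weightCoeff_mem_polyFun (α + β + 1) g r (Pi.single l 1) Finset.univ)
    (weightCoeff_reflect hrr (Pi.single l 1))
  refine ⟨bispectralOp α β h P g, bispectralOp_mem_algD α β h P g, fun n => ?_⟩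
  obtain ⟨G, hG⟩ := bispectralOp_jacobiZ hg hr (bispectralOp_jacobi hα hs hh hP hr) n
  have hrow := sum_lastCofactor_mul_row
    (fun l (j : Fin (k + 1)) => ψ l ((n : ℤ) - ((j : ℕ) : ℤ)))
  rw [qPoly_eq_sum, map_sum, Finset.smul_sum]
  simp only [map_smul]
  rw [Finset.sum_congr rfl fun (j : Fin (k + 1)) _ => by rw [hG j (Nat.lt_succ_iff.mp j.2), smul_add],
    Finset.sum_add_distrib]
  have h0 : ∑ j : Fin (k + 1),
      lastCofactor (fun l (j : Fin (k + 1)) => ψ l ((n : ℤ) - ((j : ℕ) : ℤ))) j •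
        ∑ l, ψ l ((n : ℤ) - ((j : ℕ) : ℤ)) • G l = 0 := by
    simp only [Finset.smul_sum, smul_smul]
    rw [Finset.sum_comm]
    refine Finset.sum_eq_zero fun l _ => ?_
    rw [← Finset.sum_smul, hrow l, zero_smul]
  rw [h0, add_zero]
  exact Finset.sum_congr rfl fun j _ => smul_comm _ _ _

/-! ### Leading coefficients of the q_n. -/

theorem exists_triangular_qPoly {α β : ℝ} {k : ℕ} (hα : ∀ m : ℕ, α + 1 + (m : ℝ) ≠ 0)
    (hs : ∀ m : ℕ, α + β + 1 + (m : ℝ) ≠ 0) {ψ : Fin k → ℤ → ℝ} {g : Fin k → ℝ[X]}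
    (hg : ∀ l, ∀ n : ℤ, ψ l n = (-1 : ℝ) ^ n * (g l).eval (lam (α + β + 1) (n : ℝ)))
    (hτ : ∃ n : ℤ, tau ψ n ≠ 0) :
    ∃ n₀ : ℕ, ∀ n : ℕ, n₀ ≤ n →
      (qPoly α β ψ n).coeff n ≠ 0 ∧ ∀ i, n < i → (qPoly α β ψ n).coeff i = 0 := by
  obtain ⟨D, hD⟩ := exists_eval_of_mem_polyFun (det_shiftMatrix_mem_polyFun (α + β + 1) g (-1))
  have hD0 : D ≠ 0 := by
    rintro rfl
    obtain ⟨m, hm⟩ := hτ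
    have := hD (m + 1)
    rw [add_neg_cancel_right, eval_zero, ← tau_eq hg] at this
    exact hm this.symm
  obtain ⟨n₀, hn₀⟩ : ∃ n₀ : ℕ, ∀ n : ℕ, n₀ ≤ n → D.eval (n : ℝ) ≠ 0 := by
    obtain ⟨M, hM⟩ := D.roots.toFinset.finite_toSet.bddAbove
    obtain ⟨n₀, hn₀⟩ := exists_nat_gt M
    refine ⟨n₀, fun n hn h => ?_⟩
    have h1 : (n : ℝ) ≤ M := hM (by simpa [hD0] using h)
    have h2 : (n₀ : ℝ) ≤ n := by exact_mod_cast hn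
    linarith
  have hlow : ∀ (n i j : ℕ), n < i + j → (jacobiZ α β ((n : ℤ) - j)).coeff i = 0 := by
    intro n i j h
    rcases lt_or_ge n j with hnj | hnj
    · rw [jacobiZ_of_neg α β (by omega), coeff_zero]
    · obtain ⟨m, rfl⟩ := Nat.exists_eq_add_of_le' hnj
      rw [show (((m + j : ℕ) : ℤ) - (j : ℤ)) = m by push_cast; ring, jacobiZ_natCast,
        coeff_jacobi_of_lt α β (by omega)]
  refine ⟨n₀, fun n hn => ⟨?_, fun i hi => ?_⟩⟩
  -- Only j = 0 reaches degree n; its cofactor is τ_{n-1} up to sign, nonzero for n ≥ n₀.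
  · rw [qPoly_eq_sum, finsetSum_coeff, Finset.sum_eq_single 0]
    · simp only [Fin.val_zero, Nat.cast_zero, sub_zero, jacobiZ_natCast, coeff_smul, smul_eq_mul]
      refine mul_ne_zero ?_ (coeff_jacobi_self_ne_zero hα hs n)
      rw [lastCofactor]
      refine mul_ne_zero (pow_ne_zero _ (by norm_num)) ?_
      have h1 : (Matrix.of fun l j' : Fin k =>
          ψ l ((n : ℤ) - ((((0 : Fin (k + 1)).succAbove j' : Fin (k + 1)) : ℕ) : ℤ))) =
          Matrix.of fun l j' : Fin k => ((-1 : ℝ) ^ (n + 1) * (-1) ^ (j' : ℕ)) *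
            shiftMatrix (α + β + 1) g (n + -1) l j' := by
        ext l j'
        simp only [Matrix.of_apply, Fin.zero_succAbove, Fin.val_succ, shiftMatrix]
        rw [hg, neg_one_zpow_sub, pow_succ, pow_succ]
        congr 1
        · ring
        · congr 2
          push_cast
          ring
      rw [h1, Matrix.det_mul_row, ← hD]
      exact mul_ne_zero (Finset.prod_ne_zero_iff.mpr fun j _ =>
        mul_ne_zero (pow_ne_zero _ (by norm_num)) (pow_ne_zero _ (by norm_num))) (hn₀ n hn)
    · intro j _ hj
      rw [coeff_smul, hlow, smul_zero]
      have : (j : ℕ) ≠ 0 := fun h => hj (Fin.ext h)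
      omega
    · simp
  · rw [qPoly_eq_sum, finsetSum_coeff, Finset.sum_eq_zero]
    intro j _
    rw [coeff_smul, hlow _ _ _ (by omega), smul_zero]

theorem cFactor_ne_zero {s : ℝ} {n k : ℕ} (h : ∀ m : ℕ, s - (k : ℝ) + 1 + (m : ℝ) ≠ 0) :
    cFactor s n k ≠ 0 := by
  rw [cFactor]
  split_ifs
  · exact pow_ne_zero _ (by norm_num)
  · refine mul_ne_zero (pow_ne_zero _ (by norm_num)) ?_
    have := h (2 * n)
    push_cast at this
    rwa [show 2 * (n : ℝ) + s - k + 1 = s - k + 1 + 2 * n by ring]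

end JacobiDarboux

end

/-! ### Existence, uniqueness and the intertwining relation combined. -/

open JacobiDarboux in
theorem mainTheorem5 (α β : ℝ) (k : ℕ) (hk : 1 ≤ k)
    (hα : ∀ m : ℕ, α + 1 + (m : ℝ) ≠ 0)
    (hαβ : ∀ m : ℕ, α + β - (k : ℝ) + 1 + (m : ℝ) ≠ 0)
    (ψ : Fin k → ℤ → ℝ)
    (hψ : ∀ j, ψ j ∈ JacobiDarboux.signedLamPolynomials (α + β + 1))
    (hτ : ∃ n : ℤ, JacobiDarboux.tau ψ n ≠ 0) :
    (∃! Bhat : Module.End ℝ (Polynomial ℝ), JacobiDarboux.IsBHat α β ψ Bhat) ∧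
    (∀ f ∈ JacobiDarboux.krallAlgebra α β ψ,
      ∃! Bf : Module.End ℝ (Polynomial ℝ), JacobiDarboux.IsBf α β ψ f Bf) ∧
    (∀ Bhat : Module.End ℝ (Polynomial ℝ), JacobiDarboux.IsBHat α β ψ Bhat →
      Bhat ≠ 0 ∧
      ∀ f ∈ JacobiDarboux.krallAlgebra α β ψ,
        ∀ Bf : Module.End ℝ (Polynomial ℝ), JacobiDarboux.IsBf α β ψ f Bf →
          Bf * Bhat = Bhat *
            Polynomial.aeval
              (JacobiDarboux.opM α (β - (k : ℝ)) +
                algebraMap ℝ (Module.End ℝ (Polynomial ℝ))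
                  (JacobiDarboux.lam (-α - β - 1) ((k : ℝ) / 2)))
              f) := by
  choose g hg using hψ
  have hs' : ∀ m : ℕ, α + (β - k) + 1 + (m : ℝ) ≠ 0 := fun m => by
    rw [← add_sub_assoc]; exact hαβ m
  have hs : ∀ m : ℕ, α + β + 1 + (m : ℝ) ≠ 0 := fun m => by
    have := hαβ (m + k)
    push_cast at this
    intro h
    exact this (by linarith)
  have hc : ∀ n, cFactor (α + β) n k ≠ 0 := fun n => cFactor_ne_zero hαβ
  have hbasis : ∀ n : ℕ, (jacobi α (β - k) n).coeff n ≠ 0 ∧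
      ∀ i, n < i → (jacobi α (β - k) n).coeff i = 0 :=
    fun n => ⟨coeff_jacobi_self_ne_zero hα hs' n, fun i hi => coeff_jacobi_of_lt α _ hi⟩
  obtain ⟨n₀, hn₀⟩ := exists_triangular_qPoly hα hs hg hτ
  refine ⟨?_, fun f hf => ?_, fun B hB => ⟨?_, fun f hf Bf hBf => ?_⟩⟩
  · obtain ⟨B, hB⟩ := exists_isBHat hα hs' hs hg
    refine ⟨B, hB, fun B' hB' => ext_of_triangular _ hbasis fun n => ?_⟩
    have := (hB'.2 n).symm.trans (hB.2 n)
    exact smul_right_injective _ (hc n) this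
  · obtain ⟨B, hB⟩ := exists_isBf hα hs hg hτ hf
    refine ⟨B, hB, fun B' hB' => ?_⟩
    rw [← sub_eq_zero]
    refine eq_zero_of_mem_algD hα (sub_mem hB'.1 hB.1) n₀ (fun n => qPoly α β ψ n) hn₀ fun n => ?_
    rw [LinearMap.sub_apply, hB.2, hB'.2, sub_self]
  · rintro rfl
    refine (hn₀ n₀ le_rfl).1 ?_
    rw [hB.2]
    simp
  · refine ext_of_triangular _ hbasis fun n => ?_
    have h1 := hBf.2 n
    rw [hB.2 n, map_smul, smul_comm] at h1
    have h2 := smul_right_injective _ (hc n) h1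
    rw [Module.End.mul_apply, Module.End.mul_apply, h2]
    -- The constant completes the square: it shifts the eigenvalue for β - k at n to λ_{n-k/2} for
    -- β, so both sides agree on each p_n^{α,β-k}.
    have h3 : (opM α (β - k) + algebraMap ℝ (Module.End ℝ ℝ[X]) (lam (-α - β - 1) ((k : ℝ) / 2)))
        (jacobi α (β - k) n) = lam (α + β + 1) ((n : ℝ) - k / 2) • jacobi α (β - k) n := by
      rw [LinearMap.add_apply, opM_jacobi, Module.algebraMap_end_apply, ← add_smul]
      congr 1
      simp only [lam]
      ring
    rw [Module.End.aeval_apply_of_mem_apply_eq_smul h3, map_smul]
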